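/- **Conventions.** All ultrafilters are ultrafilters on $\omega$ and non-principal. Let $\mathcal S$ be the set of all nondecreasing surjections $\phi:\omega\to\omega$. Ultrafilters $\mathcal F,\mathcal L$ are *coherent* if $\phi(\mathcal F)=\phi(\mathcal L)$ for some $\phi\in\mathcal S$; $\mathcal L$ is a *$Q$-point* if every $\phi\in\mathcal S$ is injective on some $L\in\mathcal L$. For $x,y\in\omega^\omega$ write $x\le_{\mathcal F}y$ if $\{n:x(n)\le y(n)\}\in\mathcal F$; $\mathfrak b(\mathcal F)$ is the cofinality of $(\omega^\omega,\le_{\mathcal F})$, and $\mathfrak q(\mathcal F)$ is the least size of a set $\Phi\subset\mathcal S$ such that for every $\psi\in\mathcal S$ there is $\phi\in\Phi$ with $\phi\le_{\mathcal F}\psi$. Let $X$ be a topological monoid (a monoid with a topology making multiplication continuous), with unit $1$. * $X$ is *$\omega$-bounded* if for every neighbourhood $U$ of $1$ there is a countable $C\subset X$ with $X=C\cdot U=U\cdot C$ (for a topological group it is enough that $X=C\cdot U$ for some countable $C$). * A point $x\in X$ is *left* (resp. *right*) *balanced* if for every neighbourhood $U$ of $1$ there is a neighbourhood $V$ of $1$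 with $Vx\subset xU$ (resp. $xV\subset Ux$); $X$ is *balanced* if $X=B_L\cdot U=U\cdot B_R$ for every neighbourhood $U$ of $1$, where $B_L$ and $B_R$ are the sets of left and of right balanced points. * $X$ is a *Menger monoid* if for every sequence $(U_n)_{n\in\omega}$ of open neighbourhoods of $1$ there are finite sets $F_n\subset X$ with $X=\bigcup_n(F_nU_n\cap U_nF_n)$. * $H\subset X$ is *$[\mathcal F]$-Menger* if for every sequence $(U_n)_{n\in\omega}$ of neighbourhoods of $1$ there are finite sets $F_n\subset X$ and $\phi\in\mathcal S$ with $H\subset\bigcup_{A\in\mathcal F}\bigcap_{n\in\phi(A)}(U_nF_n\cap F_nU_n)$. * $\mathrm{cf}^{\mathcal F}_m(X)$ (resp., when $X$ is a group, $\mathrm{cf}^{\mathcal F}_g(X)$) is the least length $\lambda$ of an increasing chain $\langle X_i:i<\lambda\rangle$ of proper submonoids (resp. subgroups) of $X$ such that $X=\bigcup_{i<\lambda}X_i$ and every $[\mathcal F]$-Menger subset of $X$ is contained in some $X_i$. It *exists* if there is such a chain. **Theorem.** Let $\mathcal F$ be a non-principal ultrafilter on $\omega$. Let $X$ be a first countable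 $\omega$-bounded balanced topological monoid (resp. a first countable $\omega$-bounded topological group) such that some finite power $X^k$ is not a Menger monoid. 1. If $\mathrm{cf}^{\mathcal F}_m(X)$ (resp. $\mathrm{cf}^{\mathcal F}_g(X)$) exists, then it is equal to $\mathfrak b(\mathcal F)$, and $\mathfrak b(\mathcal F)=\mathfrak q(\mathcal F)$. 2. If $\mathcal F$ is not coherent to any $Q$-point, then $\mathrm{cf}^{\mathcal F}_m(X)$ (resp. $\mathrm{cf}^{\mathcal F}_g(X)$) exists, and hence it is equal to $\mathfrak b(\mathcal F)=\mathfrak q(\mathcal F)$. 3. For the group $X$ of all homeomorphisms of the half-line $[0,\infty)$, under composition and with the compact-open topology, $\mathrm{cf}^{\mathcal F}_m(X)$ exists if and only if $\mathrm{cf}^{\mathcal F}_g(X)$ exists, if and only if $\mathcal F$ is not coherent to any $Q$-point. -/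

import Mathlib

universe u

open Filter Topology
open scoped Pointwise NNReal

namespace FMenger

/-! ### Ultrafilters on `ω`, coherence, `Q`-points, and the cardinals `𝔟(F)`, `𝔮(F)` -/

/-- `S`: the monotone (nondecreasing) surjections from `ω` onto `ω`. -/
def IsMonoSurj (φ : ℕ → ℕ) : Prop := Monotone φ ∧ Function.Surjective φ

/-- A filter on `ω` is free (non-principal) if it contains all cofinite sets. -/
def IsFree (F : Filter ℕ) : Prop := F ≤ cofinite

/-- (Near) coherence of ultrafilters: `φ(F) = φ(G)` for some monotone surjection `φ : ω → ω`. -/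
def Coherent (F G : Ultrafilter ℕ) : Prop :=
  ∃ φ : ℕ → ℕ, IsMonoSurj φ ∧ F.map φ = G.map φ

/-- `Q`-points: free ultrafilters such that each monotone surjection is injective on some
element of the ultrafilter. -/
def IsQPoint (L : Ultrafilter ℕ) : Prop :=
  IsFree L ∧ ∀ φ : ℕ → ℕ, IsMonoSurj φ → ∃ A ∈ L, Set.InjOn φ A

/-- `𝔟(F)`: the cofinality of `(ω^ω, ≤_F)`, that is, the least size of a cofinal family. -/
noncomputable def b (F : Ultrafilter ℕ) : Cardinal.{0} :=
  sInf {κ | ∃ D : Set (ℕ → ℕ), Cardinal.mk D = κ ∧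
    ∀ x : ℕ → ℕ, ∃ y ∈ D, {n | x n ≤ y n} ∈ F}

/-- `𝔮(F)`: the least size of a family `Φ` of monotone surjections which is coinitial, with
respect to `≤_F`, in the set of all monotone surjections. -/
noncomputable def q (F : Ultrafilter ℕ) : Cardinal.{0} :=
  sInf {κ | ∃ Φ : Set (ℕ → ℕ), Cardinal.mk Φ = κ ∧ (∀ φ ∈ Φ, IsMonoSurj φ) ∧
    ∀ ψ : ℕ → ℕ, IsMonoSurj ψ → ∃ φ ∈ Φ, {n | φ n ≤ ψ n} ∈ F}

/-! ### Topological monoids -/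

section Monoids

variable (X : Type u) [Monoid X] [TopologicalSpace X]

/-- `ω`-bounded: for each neighbourhood `U` of `1`, `X = C · U` for some countable `C`. -/
def IsOmegaBounded : Prop :=
  ∀ U ∈ 𝓝 (1 : X), ∃ C : Set X, C.Countable ∧ C * U = Set.univ

/-- Two-sided `ω`-boundedness: for each neighbourhood `U` of `1` there is a countable `C` with
`X = C · U = U · C`. For topological groups this is equivalent to `IsOmegaBounded`. -/
def IsTwoSidedOmegaBounded : Prop :=
  ∀ U ∈ 𝓝 (1 : X), ∃ C : Set X, C.Countable ∧ C * U = Set.univ ∧ U * C = Set.univ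

/-- The left balanced points: for each neighbourhood `U` of `1` there is a neighbourhood `V` of
`1` with `V x ⊆ x U`. -/
def leftBalancedPoints : Set X :=
  {x | ∀ U ∈ 𝓝 (1 : X), ∃ V ∈ 𝓝 (1 : X), V * {x} ⊆ {x} * U}

/-- The right balanced points: for each neighbourhood `U` of `1` there is a neighbourhood `V` of
`1` with `x V ⊆ U x`. -/
def rightBalancedPoints : Set X :=
  {x | ∀ U ∈ 𝓝 (1 : X), ∃ V ∈ 𝓝 (1 : X), {x} * V ⊆ U * {x}}

/-- Balanced monoids: `X = B_L · U` and `X = U · B_R` for each neighbourhood `U` of `1`. -/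
def IsBalanced : Prop :=
  (∀ U ∈ 𝓝 (1 : X), leftBalancedPoints X * U = Set.univ) ∧
  (∀ U ∈ 𝓝 (1 : X), U * rightBalancedPoints X = Set.univ)

/-- Menger monoids. -/
def IsMengerMonoid : Prop :=
  ∀ U : ℕ → Set X, (∀ n, IsOpen (U n) ∧ (1 : X) ∈ U n) →
    ∃ E : ℕ → Set X, (∀ n, (E n).Finite) ∧ (⋃ n, (E n * U n) ∩ (U n * E n)) = Set.univ

variable {X}

/-- `[F]`-Menger subsets `H` of a topological monoid: for each sequence `U n` of neighbourhoods
of `1` there are finite sets `E n` and a monotone surjection `φ` with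
`H ⊆ ⋃_{A ∈ F} ⋂_{n ∈ φ(A)} (U n · E n ∩ E n · U n)`. -/
def IsFMenger (F : Filter ℕ) (H : Set X) : Prop :=
  ∀ U : ℕ → Set X, (∀ n, U n ∈ 𝓝 (1 : X)) →
    ∃ E : ℕ → Set X, (∀ n, (E n).Finite) ∧ ∃ φ : ℕ → ℕ, IsMonoSurj φ ∧
      H ⊆ ⋃ A ∈ F, ⋂ n ∈ φ '' A, (U n * E n) ∩ (E n * U n)

variable (X)

/-- The lengths `lam` of increasing chains `⟨X_i : i < lam⟩` of proper submonoids of `X` which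
cover `X` and such that each `[F]`-Menger subset of `X` lies in some `X_i`. -/
def submonoidChainLengths (F : Filter ℕ) : Set Ordinal.{u} :=
  {lam | ∃ S : Set.Iio lam → Submonoid X, Monotone S ∧ (∀ i, S i ≠ ⊤) ∧
    (⋃ i, (S i : Set X)) = Set.univ ∧
    ∀ H : Set X, IsFMenger F H → ∃ i, H ⊆ (S i : Set X)}

/-- `cf^F_m(X)` exists. -/
def CfMonoidExists (F : Filter ℕ) : Prop := (submonoidChainLengths X F).Nonempty

/-- `cf^F_m(X)`, the least length of such a chain (meaningful if it exists). -/
noncomputable def cfMonoid (F : Filter ℕ) : Ordinal.{u} := sInf (submonoidChainLengths X F)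

end Monoids

/-! ### Topological groups -/

section Groups

variable (X : Type u) [Group X] [TopologicalSpace X]

/-- The lengths `lam` of increasing chains `⟨X_i : i < lam⟩` of proper subgroups of `X` which
cover `X` and such that each `[F]`-Menger subset of `X` lies in some `X_i`. -/
def subgroupChainLengths (F : Filter ℕ) : Set Ordinal.{u} :=
  {lam | ∃ S : Set.Iio lam → Subgroup X, Monotone S ∧ (∀ i, S i ≠ ⊤) ∧
    (⋃ i, (S i : Set X)) = Set.univ ∧
    ∀ H : Set X, IsFMenger F H → ∃ i, H ⊆ (S i : Set X)}

/-- `cf^F_g(X)` exists. -/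
def CfGroupExists (F : Filter ℕ) : Prop := (subgroupChainLengths X F).Nonempty

/-- `cf^F_g(X)`, the least length of such a chain (meaningful if it exists). -/
noncomputable def cfGroup (F : Filter ℕ) : Ordinal.{u} := sInf (subgroupChainLengths X F)

end Groups

/-! ### The homeomorphism group of the half-line -/

/-- The group of all homeomorphisms of the half-line `[0, ∞)`, under composition. -/
abbrev HalfLineHomeo : Type := ℝ≥0 ≃ₜ ℝ≥0

/-- The compact-open topology on the homeomorphism group of the half-line. -/
instance halfLineHomeoTopology : TopologicalSpace HalfLineHomeo :=
  TopologicalSpace.induced (fun h => (ContinuousMap.mk h h.continuous : C(ℝ≥0, ℝ≥0)))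
    ContinuousMap.compactOpen

end FMenger

/-!
Fix a neighbourhood basis `B n` at `1` and, by `ω`-boundedness and balancedness, two sequences of
balanced points that reach all of `X` at every scale (`ScaledNets`). Let `cell n i` be the set of
points approximated at scale `n` by the first `i` points of both sequences. The sets
`cellSet F φ G = {x | x ∈ cell (φ N) (G N) for F-almost all N}`, with `φ` a monotone surjection, are
`[F]`-Menger, and each `[F]`-Menger set is contained in one of them.

*The length of a chain.* For fixed `φ = id` the sets `cellSet F id G` increase along the total
preorder `≤_F` to `X`, and so do the sets `cellSet F φ id` as `φ` decreases. Suppose there is a chain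
of proper submonoids. Fewer than `𝔟(F)` points outside of the members of a chain lie in one
`[F]`-Menger set `cellSet F id G`, so each chain has length at least `𝔟(F)`; reindexing a chain by a
cofinal sequence of `G`'s gives one of length `𝔟(F)`. The same holds for `𝔮(F)`, and the two
cardinals agree (`isLeast_chainLengths`, `ScaledNets.sInf_chainLengths`).

*Existence of a chain.* If `F` is not coherent to a `Q`-point, then members of `F` have bounded gaps
(`exists_gap_bound`): for each `x` there is `z` such that every `A ∈ F` contains, for almost all
`N`, some `n` with `x n < N < z n`. Two consequences follow. The `[F]`-Menger sets have a cofinal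
family `tower F y` that increases along `≤_F`; and a product of two `[F]`-Menger sets is
`[F]`-Menger, as the two factors can be approximated at the different scales `n` and `N`
(`ScaledNets.isFMenger_cellSet_mul`). Hence `[F]`-Menger sets generate `[F]`-Menger submonoids and
subgroups. These are proper, because all finite powers of an `[F]`-Menger monoid are Menger, so the
submonoids (or subgroups) generated by the sets `tower F y` give a chain.

*The half-line.* If `F` is coherent to a `Q`-point, some image of `F` contains arbitrarily sparse
sets. In a Polish group that is Roelcke precompact (`X = U * E * U` with `E` finite), a category
argument along a sparse set factors each element into three elements of one fixed `[F]`-Menger set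
(`exists_isFMenger_mul_mul_eq_univ`), so that no chain of proper submonoids exists. The homeomorphism
group of `[0, ∞)` is such a group: its topology is that of pointwise convergence, and a double coset
of the stabilizer of a finite set is determined by finitely many order relations. It is not Menger,
because homeomorphisms grow arbitrarily fast.
-/

namespace FMenger

/-! ### Lengths of chains and cofinalities of total preorders -/

/-- The cofinality of a relation: the least size of a cofinal family. -/
noncomputable def relCof {P : Type} (r : P → P → Prop) : Cardinal.{0} :=
  sInf {κ | ∃ D : Set P, Cardinal.mk D = κ ∧ ∀ x, ∃ y ∈ D, r x y}

theorem exists_upperBound_of_lt_relCof {P : Type} {r : P → P → Prop} (htot : ∀ x y, r x y ∨ r y x)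
    {ι : Type*} (f : ι → P)
    (hι : Cardinal.mk ι < Cardinal.lift (relCof r)) : ∃ p, ∀ i, r (f i) p := by
  have h1 : Cardinal.mk (Set.range f) < relCof r := by
    have := Cardinal.mk_range_le_lift (f := f)
    rw [Cardinal.lift_uzero] at this
    exact Cardinal.lift_lt.1 (this.trans_lt hι)
  have h2 := notMem_of_lt_csInf' h1
  simp only [Set.mem_ofPred_eq, not_exists, not_and, not_forall] at h2
  obtain ⟨p, hp⟩ := h2 _ rfl
  exact ⟨p, fun i => (htot p (f i)).resolve_left (hp (f i) ⟨i, rfl⟩)⟩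

/-- A total preorder has a monotone cofinal sequence whose length is its cofinality. -/
theorem exists_monotone_cofinal {P : Type} {r : P → P → Prop} (htot : ∀ x y, r x y ∨ r y x)
    (htrans : ∀ x y z, r x y → r y z → r x z) :
    ∃ e : Set.Iio (Cardinal.lift.{u} (relCof r)).ord → P,
      (∀ i j, i ≤ j → r (e i) (e j)) ∧ ∀ x, ∃ i, r x (e i) := by
  have hrefl : ∀ x, r x x := fun x => (htot x x).elim id id
  obtain ⟨D, hD, hcof⟩ : relCof r ∈
      {κ | ∃ D : Set P, Cardinal.mk D = κ ∧ ∀ x, ∃ y ∈ D, r x y} :=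
    csInf_mem ⟨_, Set.univ, rfl, fun x => ⟨x, trivial, hrefl x⟩⟩
  set o := (Cardinal.lift.{u} (relCof r)).ord with ho
  have hcard : Cardinal.mk (Set.Iio o) = Cardinal.lift.{u + 1} (Cardinal.mk D) := by
    rw [Cardinal.mk_Iio_ordinal, ho, Cardinal.card_ord, hD, Cardinal.lift_lift]
  obtain ⟨g⟩ : Nonempty (Set.Iio o ≃ D) := by
    rw [← Cardinal.lift_mk_eq']
    simpa using hcard
  have key : ∀ (i : Set.Iio o) (f : Set.Iio i → P),
      ∃ p, r (g i) p ∧ ∀ j, r (f j) p := by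
    intro i f
    have hi : Cardinal.mk (Set.Iio i) < Cardinal.lift.{u + 1} (relCof r) := by
      have h1 : Cardinal.mk (Set.Iio i) ≤ Cardinal.mk (Set.Iio (i : Ordinal.{u})) :=
        Cardinal.mk_le_of_injective (f := fun j => ⟨j.1.1, j.2⟩) (by
          intro a b hab
          simpa [Subtype.ext_iff] using hab)
      have h2 : (i : Ordinal.{u}).card < Cardinal.lift.{u} (relCof r) :=
        Cardinal.lt_ord.1 i.2
      rw [Cardinal.mk_Iio_ordinal] at h1
      refine h1.trans_lt ?_
      have := Cardinal.lift_lt.{u, u + 1}.2 h2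
      simpa [Cardinal.lift_lift] using this
    obtain ⟨p, hp⟩ := exists_upperBound_of_lt_relCof htot f hi
    rcases htot p (g i) with h | h
    · exact ⟨g i, hrefl _, fun j => htrans _ _ _ (hp j) h⟩
    · exact ⟨p, h, hp⟩
  choose ub hub1 hub2 using key
  let e : Set.Iio o → P := (wellFounded_lt (α := Set.Iio o)).fix
    (fun i ih => ub i (fun j => ih j.1 j.2))
  have he : ∀ i, e i = ub i (fun j => e j.1) := fun i => WellFounded.fix_eq _ _ i
  refine ⟨e, fun i j hij => ?_, fun x => ?_⟩
  · rcases hij.eq_or_lt with rfl | h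
    · exact hrefl _
    · rw [he j]
      exact hub2 j (fun k => e k.1) ⟨i, h⟩
  · obtain ⟨y, hy, hxy⟩ := hcof x
    refine ⟨g.symm ⟨y, hy⟩, htrans _ _ _ hxy ?_⟩
    rw [he]
    simpa using hub1 (g.symm ⟨y, hy⟩) (fun k => e k.1)

/-- The lengths of increasing chains of members of `𝒮` that cover `X` and eventually swallow every
member of `𝓗`. -/
def chainLengths {X : Type u} (𝒮 𝓗 : Set (Set X)) : Set Ordinal.{u} :=
  {lam | ∃ S : Set.Iio lam → Set X, Monotone S ∧ (∀ i, S i ∈ 𝒮) ∧ (⋃ i, S i) = Set.univ ∧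
    ∀ H ∈ 𝓗, ∃ i, H ⊆ S i}

theorem submonoidChainLengths_eq (X : Type u) [Monoid X] [TopologicalSpace X] (F : Filter ℕ) :
    submonoidChainLengths X F =
      chainLengths {s | s ≠ Set.univ ∧ ∃ M : Submonoid X, (M : Set X) = s}
        {H | IsFMenger F H} := by
  ext lam
  constructor
  · rintro ⟨S, hmono, hne, hcov, hH⟩
    refine ⟨fun i => S i, fun i j h => hmono h, fun i => ⟨?_, S i, rfl⟩, hcov, hH⟩
    exact fun h => hne i (SetLike.coe_injective h)
  · rintro ⟨S, hmono, hne, hcov, hH⟩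
    choose h1 M hM using hne
    refine ⟨M, fun i j h => ?_, fun i h => h1 i ?_, by simpa [hM] using hcov, by simpa [hM] using hH⟩
    · rw [← SetLike.coe_subset_coe, hM, hM]
      exact hmono h
    · rw [← hM, h, Submonoid.coe_top]

theorem subgroupChainLengths_eq (X : Type u) [Group X] [TopologicalSpace X] (F : Filter ℕ) :
    subgroupChainLengths X F =
      chainLengths {s | s ≠ Set.univ ∧ ∃ M : Subgroup X, (M : Set X) = s}
        {H | IsFMenger F H} := by
  ext lam
  constructor
  · rintro ⟨S, hmono, hne, hcov, hH⟩
    refine ⟨fun i => S i, fun i j h => hmono h, fun i => ⟨?_, S i, rfl⟩, hcov, hH⟩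
    exact fun h => hne i (SetLike.coe_injective h)
  · rintro ⟨S, hmono, hne, hcov, hH⟩
    choose h1 M hM using hne
    refine ⟨M, fun i j h => ?_, fun i h => h1 i ?_, by simpa [hM] using hcov, by simpa [hM] using hH⟩
    · rw [← SetLike.coe_subset_coe, hM, hM]
      exact hmono h
    · rw [← hM, h, Subgroup.coe_top]

section Chains

variable {X : Type u} {𝒮 𝓗 : Set (Set X)} {P : Type} {r : P → P → Prop}

theorem ord_relCof_mem_chainLengths (htot : ∀ x y, r x y ∨ r y x)
    (htrans : ∀ x y z, r x y → r y z → r x z) (M : P → Set X)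
    (hM : ∀ p p', r p p' → M p ⊆ M p') (hP : ∀ p, M p ∈ 𝒮) (hcov : ∀ x, ∃ p, x ∈ M p)
    (hH : ∀ H ∈ 𝓗, ∃ p, H ⊆ M p) :
    (Cardinal.lift.{u} (relCof r)).ord ∈ chainLengths 𝒮 𝓗 := by
  obtain ⟨e, he1, he2⟩ := exists_monotone_cofinal.{u} htot htrans
  refine ⟨fun i => M (e i), fun i j h => hM _ _ (he1 i j h), fun i => hP _, ?_, fun H h => ?_⟩
  · refine Set.eq_univ_of_forall fun x => ?_
    obtain ⟨p, hp⟩ := hcov x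
    obtain ⟨i, hi⟩ := he2 p
    exact Set.mem_iUnion.2 ⟨i, hM _ _ hi hp⟩
  · obtain ⟨p, hp⟩ := hH H h
    obtain ⟨i, hi⟩ := he2 p
    exact ⟨i, hp.trans (hM _ _ hi)⟩

/-- If `X` is covered by a family of members of `𝓗` that increases along a total preorder, then the
cofinality of that preorder is the least length of a chain, as soon as there is a chain: points
outside of fewer members of a chain can be put into one member of `𝓗`, and a chain can be reindexed
by the preorder. -/
theorem isLeast_chainLengths (huniv : Set.univ ∉ 𝒮) (htot : ∀ x y, r x y ∨ r y x)
    (htrans : ∀ x y z, r x y → r y z → r x z) (T : P → Set X)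
    (hT : ∀ p p', r p p' → T p ⊆ T p') (hTH : ∀ p, T p ∈ 𝓗) (hcov : ∀ x, ∃ p, x ∈ T p)
    (hne : (chainLengths 𝒮 𝓗).Nonempty) :
    IsLeast (chainLengths 𝒮 𝓗) (Cardinal.lift.{u} (relCof r)).ord := by
  constructor
  · obtain ⟨lam, S, hmono, hP, hun, hH⟩ := hne
    have hwf := wellFounded_lt (α := Set.Iio lam)
    have hN : ∀ p, {i | T p ⊆ S i}.Nonempty := fun p => hH _ (hTH p)
    refine ord_relCof_mem_chainLengths htot htrans (fun p => S (hwf.min _ (hN p))) ?_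
      (fun p => hP _) (fun x => ?_) (fun H h => ?_)
    · refine fun p p' h => hmono (not_lt.1 (hwf.not_lt_min _ ?_))
      exact (hT p p' h).trans (hwf.min_mem _ (hN p'))
    · obtain ⟨p, hp⟩ := hcov x
      exact ⟨p, hwf.min_mem _ (hN p) hp⟩
    · obtain ⟨i, hi⟩ := hH H h
      obtain ⟨x, hx⟩ : ∃ x, x ∉ S i := by
        by_contra! hall
        exact huniv (Set.eq_univ_of_forall hall ▸ hP i)
      obtain ⟨p, hp⟩ := hcov x
      refine ⟨p, hi.trans (hmono (le_of_not_ge fun hle => hx ?_))⟩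
      exact hmono hle (hwf.min_mem _ (hN p) hp)
  · rintro lam ⟨S, hmono, hP, hun, hH⟩
    by_contra! hlt
    have hx : ∀ i, ∃ x, x ∉ S i := fun i => by
      by_contra! hall
      exact huniv (Set.eq_univ_of_forall hall ▸ hP i)
    choose x hx using hx
    choose p hp using fun i => hcov (x i)
    have hcard : Cardinal.mk (Set.Iio lam) < Cardinal.lift.{u + 1} (relCof r) := by
      rw [Cardinal.mk_Iio_ordinal]
      have := Cardinal.lift_lt.{u, u + 1}.2 (Cardinal.lt_ord.1 hlt)
      simpa [Cardinal.lift_lift] using this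
    obtain ⟨p₀, hp₀⟩ := exists_upperBound_of_lt_relCof htot p hcard
    obtain ⟨i, hi⟩ := hH _ (hTH p₀)
    exact hx i (hi (hT _ _ (hp₀ i) (hp i)))

end Chains

/-! ### Monotone surjections and ultrafilters that are not coherent to `Q`-points -/

/-- The index `k` of the interval `[t k, t (k + 1))` that contains `N` (and `0` if `N < t 0`). -/
def intervalIndex (t : ℕ → ℕ) (N : ℕ) : ℕ := Nat.findGreatest (fun k => t k ≤ N) N

section IntervalIndex

variable {t : ℕ → ℕ}

theorem le_intervalIndex (ht : StrictMono t) {k N : ℕ} (h : t k ≤ N) : k ≤ intervalIndex t N :=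
  Nat.le_findGreatest (ht.le_apply.trans h) h

theorem apply_le_of_le_intervalIndex (ht : StrictMono t) {k N : ℕ} (hk : k ≠ 0)
    (h : k ≤ intervalIndex t N) : t k ≤ N :=
  (ht.monotone h).trans
    (Nat.findGreatest_of_ne_zero (P := fun k => t k ≤ N) rfl fun h0 => hk (by
      have : intervalIndex t N = 0 := h0
      omega))

theorem apply_intervalIndex_le (ht : StrictMono t) {N : ℕ} (h : t 0 ≤ N) :
    t (intervalIndex t N) ≤ N := by
  rcases eq_or_ne (intervalIndex t N) 0 with h0 | h0
  · rwa [h0]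
  · exact apply_le_of_le_intervalIndex ht h0 le_rfl

theorem lt_apply_intervalIndex_succ (ht : StrictMono t) (N : ℕ) :
    N < t (intervalIndex t N + 1) := by
  by_contra! h
  have := le_intervalIndex ht h
  omega

theorem intervalIndex_apply (ht : StrictMono t) (k : ℕ) : intervalIndex t (t k) = k := by
  refine le_antisymm ?_ (le_intervalIndex ht le_rfl)
  by_contra! h
  exact absurd (apply_le_of_le_intervalIndex ht (by omega) le_rfl) (not_le.2 (ht h))

theorem isMonoSurj_intervalIndex (ht : StrictMono t) : IsMonoSurj (intervalIndex t) := by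
  refine ⟨fun a b hab => ?_, fun k => ⟨t k, intervalIndex_apply ht k⟩⟩
  rcases eq_or_ne (intervalIndex t a) 0 with h0 | h0
  · omega
  · exact le_intervalIndex ht ((apply_le_of_le_intervalIndex ht h0 le_rfl).trans hab)

end IntervalIndex

theorem IsMonoSurj.tendsto {φ : ℕ → ℕ} (h : IsMonoSurj φ) : Tendsto φ atTop atTop :=
  tendsto_atTop_atTop_of_monotone h.1 fun k => (h.2 k).imp fun _ h => h.ge

theorem IsFree.le_atTop {F : Filter ℕ} (hF : IsFree F) : F ≤ atTop := by
  rw [← Nat.cofinite_eq_atTop]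
  exact hF

/-- A property that holds eventually for each `n` holds along a sufficiently slow monotone
surjection. -/
theorem exists_isMonoSurj_eventually {Q : ℕ → ℕ → Prop} (h : ∀ n, ∀ᶠ N in atTop, Q n N) :
    ∃ φ, IsMonoSurj φ ∧ ∀ᶠ N in atTop, Q (φ N) N := by
  obtain ⟨t, ht, hQ⟩ := extraction_forall_of_eventually (P := fun n k => ∀ N ≥ k, Q n N)
    fun n => by
      obtain ⟨k, hk⟩ := eventually_atTop.1 (h n)
      exact eventually_atTop.2 ⟨k, fun b hb N hN => hk N (hb.trans hN)⟩
  refine ⟨_, isMonoSurj_intervalIndex ht, eventually_atTop.2 ⟨t 0, fun N hN => ?_⟩⟩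
  exact hQ _ N (apply_intervalIndex_le ht hN)

theorem exists_strictMono_eventually {Q : ℕ → ℕ → Prop} (h : ∀ n, ∀ᶠ N in atTop, Q n N) :
    ∃ t, StrictMono t ∧ ∀ n, Q n (t n) :=
  extraction_forall_of_eventually h

theorem exists_strictMono_ge (y : ℕ → ℕ) : ∃ t, StrictMono t ∧ ∀ n, y n ≤ t n :=
  exists_strictMono_eventually fun n => eventually_ge_atTop (y n)

/-- A monotone surjection dominates the interval index of some strictly increasing sequence. -/
theorem IsMonoSurj.exists_intervalIndex_le {φ : ℕ → ℕ} (h : IsMonoSurj φ) :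
    ∃ t, StrictMono t ∧ ∀ N, intervalIndex t N ≤ φ N := by
  obtain ⟨t, ht, htφ⟩ := exists_strictMono_eventually (Q := fun n N => n ≤ φ N)
    fun n => h.tendsto.eventually_ge_atTop n
  refine ⟨t, ht, fun N => ?_⟩
  rcases eq_or_ne (intervalIndex t N) 0 with h0 | h0
  · omega
  · exact (htφ _).trans (h.1 (apply_le_of_le_intervalIndex ht h0 le_rfl))

/-- For each ultrafilter one of the two unions of alternate fibres of `φ` is large. -/
theorem exists_mem_mod_two_eq (F : Ultrafilter ℕ) (φ : ℕ → ℕ) :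
    ∃ A ∈ F, ∀ n ∈ A, ∀ m ∈ A, φ n % 2 = φ m % 2 := by
  by_cases h : {n | φ n % 2 = 0} ∈ F
  · exact ⟨_, h, fun n hn m hm => hn.trans hm.symm⟩
  · refine ⟨_, Ultrafilter.compl_mem_iff_notMem.2 h, fun n hn m hm => ?_⟩
    simp only [Set.mem_compl_iff, Set.mem_ofPred_eq] at hn hm
    omega

/-- The iterates of `x` at `0` cut `ℕ` into intervals `[p k, x (p k))`. -/
theorem strictMono_iterate_zero {x : ℕ → ℕ} (hlt : ∀ n, n < x n) :
    StrictMono fun k => x^[k] 0 :=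
  strictMono_nat_of_lt_succ fun k => by
    rw [Function.iterate_succ_apply']
    exact hlt _

/-- If `F` is not coherent to a `Q`-point then no large set is sparse: for each `x` there is `z`
such that each large set contains, for almost all `N`, some `n` with `x n < N < z n`.
Let `p` be the iterates of `x` and `π N` the last `p k` with `p k ≤ N`. The ultrafilter `π(F)` is coherent
to `F`, so it is not a `Q`-point, and a surjection that is injective on none of its members gives
`z`. -/
theorem exists_gap_bound {F : Ultrafilter ℕ} (hF : IsFree F)
    (hQ : ∀ L : Ultrafilter ℕ, IsQPoint L → ¬ Coherent F L) {x : ℕ → ℕ} (hx : StrictMono x) :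
    ∃ z : ℕ → ℕ, StrictMono z ∧ ∀ A ∈ F, ∀ᶠ N in (F : Filter ℕ), ∃ n ∈ A, x n < N ∧ N < z n := by
  -- it suffices to treat a sequence without fixed points
  wlog hlt : ∀ n, n < x n generalizing x
  · obtain ⟨z, hz, h⟩ := this (x := fun n => x n + 1) (fun a b h => by simpa using hx h)
      fun n => Nat.lt_succ_of_le hx.le_apply
    refine ⟨z, hz, fun A hA => (h A hA).mono fun N hN => ?_⟩
    obtain ⟨n, hn, h1, h2⟩ := hN
    exact ⟨n, hn, by omega, h2⟩
  set p : ℕ → ℕ := fun k => x^[k] 0 with hp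
  have hpm : StrictMono p := strictMono_iterate_zero hlt
  have hpx : ∀ k, p (k + 1) = x (p k) := fun k => Function.iterate_succ_apply' _ _ _
  set φ := intervalIndex p with hφ
  have hφS : IsMonoSurj φ := isMonoSurj_intervalIndex hpm
  have hle : ∀ N, p (φ N) ≤ N := fun N => apply_intervalIndex_le hpm (Nat.zero_le N)
  have hltN : ∀ N, N < p (φ N + 1) := lt_apply_intervalIndex_succ hpm
  set L : Ultrafilter ℕ := F.map (p ∘ φ) with hL
  have hcoh : Coherent F L := by
    refine ⟨φ, hφS, ?_⟩
    rw [hL, Ultrafilter.map_map]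
    congr 1
    ext N
    exact (intervalIndex_apply hpm (φ N)).symm
  have hLfree : IsFree L := by
    have : Tendsto (p ∘ φ) F atTop :=
      (hpm.tendsto_atTop.comp hφS.tendsto).mono_left hF.le_atTop
    rw [IsFree, Nat.cofinite_eq_atTop]
    exact this
  have hnQ : ¬ IsQPoint L := fun h => hQ L h hcoh
  simp only [IsQPoint, hLfree, true_and, not_forall, not_exists, not_and] at hnQ
  obtain ⟨ψ, hψ, hinj⟩ := hnQ
  -- `T k` bounds the fibres of `ψ` over `0, …, k`
  have hT : ∀ k, ∃ T, ∀ m, ψ m ≤ k → m ≤ T := fun k => by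
    obtain ⟨T, hT⟩ := eventually_atTop.1 (hψ.tendsto.eventually_gt_atTop k)
    refine ⟨T, fun m hm => ?_⟩
    by_contra! h
    exact absurd (hT m h.le) (not_lt.2 hm)
  choose T hT using hT
  obtain ⟨z, hz, hzT⟩ := exists_strictMono_ge fun n => x (T (ψ n))
  refine ⟨z, hz, fun A hA => ?_⟩
  by_contra hB
  rw [Ultrafilter.eventually_not.symm] at hB
  obtain ⟨C, hC, hpar⟩ := exists_mem_mod_two_eq F φ
  set A' := A ∩ {N | ¬ ∃ n ∈ A, x n < N ∧ N < z n} ∩ C with hA'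
  have hA'F : A' ∈ F := inter_mem (inter_mem hA hB) hC
  refine hinj ((p ∘ φ) '' A') (Ultrafilter.mem_map.2
    (mem_of_superset hA'F (Set.subset_preimage_image _ _))) ?_
  have key : ∀ n ∈ A', ∀ N ∈ A', ψ (p (φ n)) = ψ (p (φ N)) → ¬ φ n < φ N := by
    intro n hn N hN hψe hlt'
    have hp2 : φ n + 2 ≤ φ N := by
      have := hpar n hn.2 N hN.2
      omega
    refine hN.1.2 ⟨n, hn.1.1, ?_, ?_⟩
    · calc x n < x (p (φ n + 1)) := hx (hltN n)
        _ = p (φ n + 2) := (hpx _).symm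
        _ ≤ p (φ N) := hpm.monotone hp2
        _ ≤ N := hle N
    · calc N < p (φ N + 1) := hltN N
        _ = x (p (φ N)) := hpx _
        _ ≤ x (T (ψ n)) := hx.monotone (hT _ _ (hψe ▸ hψ.1 (hle n)))
        _ ≤ z n := hzT n
  rintro _ ⟨n, hn, rfl⟩ _ ⟨N, hN, rfl⟩ he
  rcases lt_trichotomy (φ n) (φ N) with h | h | h
  · exact absurd h (key n hn N hN he)
  · simp only [Function.comp_apply, h]
  · exact absurd h (key N hN n hn he.symm)

/-- A `Q`-point contains arbitrarily sparse sets: take at most one point from each of the intervals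
between iterates of a bound for `θ`, and only intervals whose indices have the same parity. -/
theorem IsQPoint.exists_sparse {L : Ultrafilter ℕ} (hL : IsQPoint L) (θ : ℕ → ℕ) :
    ∃ A ∈ L, ∀ n ∈ A, ∀ m ∈ A, n < m → θ n ≤ m := by
  obtain ⟨x, hx, hθ⟩ := exists_strictMono_ge fun n => max (θ n) (n + 1)
  have hlt : ∀ n, n < x n := fun n => (le_max_right (θ n) (n + 1)).trans (hθ n)
  set p : ℕ → ℕ := fun k => x^[k] 0 with hp
  have hpm : StrictMono p := strictMono_iterate_zero hlt
  have hpx : ∀ k, p (k + 1) = x (p k) := fun k => Function.iterate_succ_apply' _ _ _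
  set φ := intervalIndex p with hφ
  have hφS : IsMonoSurj φ := isMonoSurj_intervalIndex hpm
  obtain ⟨A, hA, hinj⟩ := hL.2 φ hφS
  obtain ⟨C, hC, hpar⟩ := exists_mem_mod_two_eq L φ
  refine ⟨A ∩ C, inter_mem hA hC, fun n hn m hm hnm => ?_⟩
  have h1 : φ n < φ m :=
    (hφS.1 hnm.le).lt_of_ne fun h => hnm.ne (hinj hn.1 hm.1 h)
  have h2 : φ n + 2 ≤ φ m := by
    have := hpar n hn.2 m hm.2
    omega
  calc θ n ≤ x n := (le_max_left _ _).trans (hθ n)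
    _ ≤ x (p (φ n + 1)) := hx.monotone (lt_apply_intervalIndex_succ hpm n).le
    _ = p (φ n + 2) := (hpx _).symm
    _ ≤ p (φ m) := hpm.monotone h2
    _ ≤ m := apply_intervalIndex_le hpm (Nat.zero_le m)

/-- If `F` is coherent to a `Q`-point then some image of `F` under a monotone surjection contains
arbitrarily sparse sets. -/
theorem exists_sparse_map_of_coherent {F L : Ultrafilter ℕ} (hL : IsQPoint L) (h : Coherent F L) :
    ∃ φ, IsMonoSurj φ ∧ ∀ θ : ℕ → ℕ, ∃ A ∈ F.map φ, ∀ n ∈ A, ∀ m ∈ A, n < m → θ n ≤ m := by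
  obtain ⟨φ, hφ, hFL⟩ := h
  refine ⟨φ, hφ, fun θ => ?_⟩
  have h1 : ∀ n, ∃ T, ∀ m, T ≤ m → θ (φ n) ≤ φ m := fun n =>
    eventually_atTop.1 (hφ.tendsto.eventually_ge_atTop _)
  choose T hT using h1
  obtain ⟨A, hA, hsp⟩ := hL.exists_sparse T
  refine ⟨φ '' A, ?_, ?_⟩
  · rw [hFL]
    exact Ultrafilter.mem_map.2 (mem_of_superset hA (Set.subset_preimage_image _ _))
  · rintro _ ⟨n, hn, rfl⟩ _ ⟨m, hm, rfl⟩ hlt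
    exact hT n m (hsp n hn m hm (lt_of_not_ge fun hle => absurd (hφ.1 hle) (not_le.2 hlt)))

/-! ### `[F]`-Menger sets in first countable `ω`-bounded balanced monoids -/

/-- A neighbourhood basis `B` at `1` together with two sequences of points that reach all of `X` at
every scale, from the left (through left balanced points) and from the right (through right balanced
points). -/
structure ScaledNets (X : Type u) [Monoid X] [TopologicalSpace X] where
  /-- the neighbourhood basis at `1` -/
  B : ℕ → Set X
  /-- the left net -/
  cL : ℕ → X
  /-- the right net -/
  cR : ℕ → X
  basis : (𝓝 (1 : X)).HasAntitoneBasis B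
  mul_subset : ∀ n, B (n + 1) * B (n + 1) ⊆ B n
  left_mem : ∀ n x, ∃ i, x ∈ {cL i} * B n
  right_mem : ∀ n x, ∃ i, x ∈ B n * {cR i}
  cL_balanced : ∀ i, cL i ∈ leftBalancedPoints X
  cR_balanced : ∀ i, cR i ∈ rightBalancedPoints X

section Nets

variable {X : Type u} [Monoid X] [TopologicalSpace X]

theorem exists_antitone_basis_mul_subset [ContinuousMul X] [FirstCountableTopology X] :
    ∃ B : ℕ → Set X, (𝓝 (1 : X)).HasAntitoneBasis B ∧ ∀ n, B (n + 1) * B (n + 1) ⊆ B n := by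
  obtain ⟨u, hu⟩ := (𝓝 (1 : X)).exists_antitone_basis
  obtain ⟨φ, -, hφ, hb⟩ := hu.subbasis_with_rel (r := fun m n => u n * u n ⊆ u m) fun m => by
    obtain ⟨V, hV, hVV⟩ := exists_nhds_one_split (hu.mem m)
    filter_upwards [hu.eventually_subset hV] with n hn
    rintro _ ⟨a, ha, b, hb, rfl⟩
    exact hVV a (hn ha) b (hn hb)
  exact ⟨u ∘ φ, hb, fun n => hφ n.lt_succ_self⟩

theorem nonempty_scaledNets [ContinuousMul X] [FirstCountableTopology X]
    (hb : IsTwoSidedOmegaBounded X) (hbal : IsBalanced X) : Nonempty (ScaledNets X) := by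
  obtain ⟨B, hB, hmul⟩ := exists_antitone_basis_mul_subset (X := X)
  choose C hCc hCL hCR using fun n => hb (B n) (hB.mem n)
  have hL : ∀ n x, ∃ b ∈ leftBalancedPoints X, x ∈ {b} * B n := fun n x => by
    obtain ⟨b, hb, w, hw, h⟩ := (hbal.1 _ (hB.mem n)).ge (Set.mem_univ x)
    exact ⟨b, hb, b, rfl, w, hw, h⟩
  have hR : ∀ n x, ∃ b ∈ rightBalancedPoints X, x ∈ B n * {b} := fun n x => by
    obtain ⟨w, hw, b, hb, h⟩ := (hbal.2 _ (hB.mem n)).ge (Set.mem_univ x)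
    exact ⟨b, hb, w, hw, b, rfl, h⟩
  choose fL hfL hfL' using hL
  choose fR hfR hfR' using hR
  have hne : ∀ n, (C n).Nonempty := fun n => by
    obtain ⟨c, hc, -⟩ := (hCL n).ge (Set.mem_univ 1)
    exact ⟨c, hc⟩
  obtain ⟨cL, hcL⟩ := (Set.countable_iUnion fun n => (hCc (n + 1)).image (fL (n + 1))).exists_eq_range
    (Set.nonempty_iUnion.2 ⟨0, (hne 1).image _⟩)
  obtain ⟨cR, hcR⟩ := (Set.countable_iUnion fun n => (hCc (n + 1)).image (fR (n + 1))).exists_eq_range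
    (Set.nonempty_iUnion.2 ⟨0, (hne 1).image _⟩)
  refine ⟨⟨B, cL, cR, hB, hmul, fun n x => ?_, fun n x => ?_, fun i => ?_, fun i => ?_⟩⟩
  · obtain ⟨c, hc, w, hw, rfl⟩ := (hCL (n + 1)).ge (Set.mem_univ x)
    obtain ⟨i, hi⟩ : fL (n + 1) c ∈ Set.range cL :=
      hcL ▸ Set.mem_iUnion.2 ⟨n, c, hc, rfl⟩
    obtain ⟨_, rfl, v, hv, h⟩ := hfL' (n + 1) c
    refine ⟨i, cL i, rfl, v * w, hmul n ⟨v, hv, w, hw, rfl⟩, ?_⟩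
    simp only at h ⊢
    rw [hi, ← mul_assoc, h]
  · obtain ⟨w, hw, c, hc, rfl⟩ := (hCR (n + 1)).ge (Set.mem_univ x)
    obtain ⟨i, hi⟩ : fR (n + 1) c ∈ Set.range cR :=
      hcR ▸ Set.mem_iUnion.2 ⟨n, c, hc, rfl⟩
    obtain ⟨v, hv, _, rfl, h⟩ := hfR' (n + 1) c
    refine ⟨i, w * v, hmul n ⟨w, hw, v, hv, rfl⟩, cR i, rfl, ?_⟩
    simp only at h ⊢
    rw [hi, mul_assoc, h]
  · obtain ⟨n, c, -, hc⟩ := Set.mem_iUnion.1 (hcL ▸ Set.mem_range_self i)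
    exact hc ▸ hfL _ _
  · obtain ⟨n, c, -, hc⟩ := Set.mem_iUnion.1 (hcR ▸ Set.mem_range_self i)
    exact hc ▸ hfR _ _

/-- A criterion for being `[F]`-Menger that only mentions one neighbourhood basis `B`, along which
one moves at any speed `M`. -/
theorem isFMenger_of_eventually {F : Filter ℕ} (hF : F ≤ atTop) {B : ℕ → Set X}
    (hB : (𝓝 (1 : X)).HasAntitoneBasis B) {P : ℕ → Set X} (hP : ∀ N, (P N).Finite) {M : ℕ → ℕ}
    (hM : Tendsto M atTop atTop) {H : Set X}
    (hH : ∀ x ∈ H, ∀ᶠ N in F, x ∈ (P N * B (M N)) ∩ (B (M N) * P N)) : IsFMenger F H := by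
  intro U hU
  obtain ⟨φ, hφ, hev⟩ := exists_isMonoSurj_eventually (Q := fun n N => B (M N) ⊆ U n) fun n =>
    hM.eventually (hB.eventually_subset (hU n))
  refine ⟨fun n => ⋃ N ∈ {N | φ N = n}, P N, fun n => ?_, φ, hφ, fun x hx => ?_⟩
  · refine Set.Finite.biUnion ?_ fun N _ => hP N
    obtain ⟨T, hT⟩ := eventually_atTop.1 (hφ.tendsto.eventually_gt_atTop n)
    refine (Set.finite_Iio T).subset fun N hN => ?_
    by_contra h
    exact absurd (hT N (not_lt.1 h)) (by simp_all)
  · simp only [Set.mem_iUnion]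
    refine ⟨{N | x ∈ (P N * B (M N)) ∩ (B (M N) * P N) ∧ B (M N) ⊆ U (φ N)},
      (hH x hx).and (hF hev), ?_⟩
    simp only [Set.mem_iInter]
    rintro _ ⟨N, ⟨⟨h1, h2⟩, hsub⟩, rfl⟩
    have hPsub : P N ⊆ ⋃ N' ∈ {N' | φ N' = φ N}, P N' :=
      Set.subset_biUnion_of_mem (u := fun N' => P N') (show N ∈ {N' | φ N' = φ N} from rfl)
    exact ⟨Set.mul_subset_mul hsub hPsub h2, Set.mul_subset_mul hPsub hsub h1⟩

theorem IsFMenger.mono {F : Filter ℕ} {H H' : Set X} (h : IsFMenger F H') (hs : H ⊆ H') :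
    IsFMenger F H := fun U hU => by
  obtain ⟨E, hE, φ, hφ, hsub⟩ := h U hU
  exact ⟨E, hE, φ, hφ, hs.trans hsub⟩

/-- If the whole monoid is `[F]`-Menger, all finite powers are Menger: finitely many members of
`φ(F)` have a common point. -/
theorem isMengerMonoid_pi_of_isFMenger_univ (F : Ultrafilter ℕ)
    (h : IsFMenger (F : Filter ℕ) (Set.univ : Set X)) (k : ℕ) : IsMengerMonoid (Fin k → X) := by
  intro U hU
  have hV : ∀ n, ∃ V ∈ 𝓝 (1 : X), (Set.univ.pi fun _ : Fin k => V) ⊆ U n := fun n => by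
    have h1 := (hU n).1.mem_nhds (hU n).2
    rw [nhds_pi, Filter.mem_pi] at h1
    obtain ⟨I, hI, t, ht, hsub⟩ := h1
    refine ⟨⋂ i, t i, Filter.iInter_mem.2 ht, fun f hf => hsub fun i _ => ?_⟩
    exact Set.mem_iInter.1 (hf i trivial) i
  choose V hV hVU using hV
  obtain ⟨E, hE, φ, hφ, hsub⟩ := h V hV
  refine ⟨fun n => Set.univ.pi fun _ => E n, fun n => Set.Finite.pi fun _ => hE n, ?_⟩
  refine Set.eq_univ_of_forall fun f => ?_
  have hf : ∀ i, ∀ᶠ N in (F : Filter ℕ), f i ∈ (V (φ N) * E (φ N)) ∩ (E (φ N) * V (φ N)) :=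
    fun i => by
      obtain ⟨A, hA, hi⟩ := Set.mem_iUnion₂.1 (hsub (Set.mem_univ (f i)))
      exact mem_of_superset hA fun N hN => Set.mem_iInter₂.1 hi _ ⟨N, hN, rfl⟩
  obtain ⟨N, hN⟩ := (eventually_all.2 hf).exists
  refine Set.mem_iUnion.2 ⟨φ N, ?_, ?_⟩
  · choose e he v hv hev using fun i => (hN i).2
    exact ⟨e, fun i _ => he i, v, hVU _ fun i _ => hv i, funext hev⟩
  · choose v hv e he hev using fun i => (hN i).1
    exact ⟨v, hVU _ fun i _ => hv i, e, fun i _ => he i, funext hev⟩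

end Nets

namespace ScaledNets

variable {X : Type u} [Monoid X] [TopologicalSpace X] (s : ScaledNets X)

/-- The points approximated at scale `n`, from both sides, by the first points of the nets. -/
def cell (n i : ℕ) : Set X := (s.cL '' Set.Iic i * s.B n) ∩ (s.B n * s.cR '' Set.Iic i)

theorem cell_mono {n n' i i' : ℕ} (hn : n' ≤ n) (hi : i ≤ i') : s.cell n i ⊆ s.cell n' i' := by
  have h1 := s.basis.antitone hn
  have h2 : Set.Iic i ⊆ Set.Iic i' := Set.Iic_subset_Iic.2 hi
  exact Set.inter_subset_inter (Set.mul_subset_mul (Set.image_mono h2) h1)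
    (Set.mul_subset_mul h1 (Set.image_mono h2))

theorem exists_mem_cell (n : ℕ) (x : X) : ∃ i, x ∈ s.cell n i := by
  obtain ⟨i, hi⟩ := s.left_mem n x
  obtain ⟨j, hj⟩ := s.right_mem n x
  refine ⟨max i j, Set.mul_subset_mul_right ?_ hi, Set.mul_subset_mul_left ?_ hj⟩
  · exact Set.singleton_subset_iff.2 ⟨i, le_max_left i j, rfl⟩
  · exact Set.singleton_subset_iff.2 ⟨j, le_max_right i j, rfl⟩

/-- The points `x` which, along `F`, lie in `cell (M N) (G N)`. -/
def cellSet (F : Filter ℕ) (M G : ℕ → ℕ) : Set X := {x | ∀ᶠ N in F, x ∈ s.cell (M N) (G N)}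

variable {F : Ultrafilter ℕ}

theorem cellSet_mono {M M' G G' : ℕ → ℕ} (hM : ∀ᶠ N in (F : Filter ℕ), M' N ≤ M N)
    (hG : ∀ᶠ N in (F : Filter ℕ), G N ≤ G' N) : s.cellSet F M G ⊆ s.cellSet F M' G' :=
  fun _ hx => (hx.and (hM.and hG)).mono fun _ h => s.cell_mono h.2.1 h.2.2 h.1

theorem isFMenger_cellSet (hF : IsFree F) {M : ℕ → ℕ} (hM : Tendsto M atTop atTop) (G : ℕ → ℕ) :
    IsFMenger (F : Filter ℕ) (s.cellSet F M G) := by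
  refine isFMenger_of_eventually hF.le_atTop s.basis (M := M)
    (P := fun N => s.cL '' Set.Iic (G N) ∪ s.cR '' Set.Iic (G N))
    (fun N => ((Set.finite_Iic _).image _).union ((Set.finite_Iic _).image _)) hM ?_
  intro x hx
  refine hx.mono fun N h => ⟨?_, ?_⟩
  · exact Set.mul_subset_mul_right Set.subset_union_left h.1
  · exact Set.mul_subset_mul_left Set.subset_union_right h.2

/-- Each `[F]`-Menger set lies in a set `cellSet F φ G`: test it against the basis shifted by one,
so that replacing the points of the finite sets by points of the nets is harmless. -/
theorem subset_cellSet_of_isFMenger {H : Set X} (h : IsFMenger (F : Filter ℕ) H) :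
    ∃ φ G, IsMonoSurj φ ∧ H ⊆ s.cellSet F φ G := by
  obtain ⟨E, hE, φ, hφ, hsub⟩ := h (fun n => s.B (n + 1)) fun n => s.basis.mem _
  have hi : ∀ n, ∃ i, ∀ e ∈ E n, e ∈ s.cell (n + 1) i := fun n => by
    choose i hi using s.exists_mem_cell (n + 1)
    obtain ⟨b, hb⟩ := ((hE n).image i).bddAbove
    exact ⟨b, fun e he => s.cell_mono le_rfl (hb ⟨e, he, rfl⟩) (hi e)⟩
  choose i hi using hi
  refine ⟨φ, fun N => i (φ N), hφ, fun x hx => ?_⟩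
  obtain ⟨A, hA, hxA⟩ := Set.mem_iUnion₂.1 (hsub hx)
  refine mem_of_superset hA fun N hN => ?_
  obtain ⟨⟨v, hv, e, he, hve⟩, ⟨e', he', v', hv', hve'⟩⟩ := Set.mem_iInter₂.1 hxA _ ⟨N, hN, rfl⟩
  constructor
  · obtain ⟨c, hc, w, hw, hcw⟩ := (hi _ e' he').1
    refine ⟨c, hc, w * v', s.mul_subset _ ⟨w, hw, v', hv', rfl⟩, ?_⟩
    simp only at hcw hve' ⊢
    rw [← mul_assoc, hcw, hve']
  · obtain ⟨w, hw, c, hc, hcw⟩ := (hi _ e he).2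
    refine ⟨v * w, s.mul_subset _ ⟨v, hv, w, hw, rfl⟩, c, hc, ?_⟩
    simp only at hcw hve ⊢
    rw [mul_assoc, hcw, hve]

theorem exists_mem_cellSet_id (x : X) : ∃ G, x ∈ s.cellSet F id G := by
  choose i hi using fun n => s.exists_mem_cell n x
  exact ⟨i, Eventually.of_forall hi⟩

theorem exists_mem_cellSet_isMonoSurj (hF : IsFree F) (x : X) :
    ∃ φ, IsMonoSurj φ ∧ x ∈ s.cellSet F φ id := by
  obtain ⟨φ, hφ, hev⟩ := exists_isMonoSurj_eventually (Q := fun n N => x ∈ s.cell n N) fun n => by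
    obtain ⟨i, hi⟩ := s.exists_mem_cell n x
    exact eventually_atTop.2 ⟨i, fun N hN => s.cell_mono le_rfl hN hi⟩
  exact ⟨φ, hφ, hF.le_atTop hev⟩

end ScaledNets

/-! ### The least length of a chain -/

theorem b_eq_relCof (F : Ultrafilter ℕ) :
    b F = relCof fun x y : ℕ → ℕ => {n | x n ≤ y n} ∈ F := rfl

theorem q_eq_relCof (F : Ultrafilter ℕ) :
    q F = relCof fun x y : {φ // IsMonoSurj φ} => {n | y.1 n ≤ x.1 n} ∈ F := by
  rw [q, relCof]
  congr 1
  ext κ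
  constructor
  · rintro ⟨Φ, rfl, hΦ, hc⟩
    refine ⟨Subtype.val ⁻¹' Φ, ?_, fun x => ?_⟩
    · exact Cardinal.mk_preimage_of_injective_of_subset_range _ _ Subtype.val_injective
        fun φ hφ => ⟨⟨φ, hΦ φ hφ⟩, rfl⟩
    · obtain ⟨φ, hφ, h⟩ := hc x.1 x.2
      exact ⟨⟨φ, hΦ φ hφ⟩, hφ, h⟩
  · rintro ⟨D, rfl, hD⟩
    refine ⟨Subtype.val '' D, Cardinal.mk_image_eq Subtype.val_injective, ?_, fun ψ hψ => ?_⟩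
    · rintro _ ⟨φ, -, rfl⟩
      exact φ.2
    · obtain ⟨y, hy, h⟩ := hD ⟨ψ, hψ⟩
      exact ⟨y.1, ⟨y, hy, rfl⟩, h⟩

theorem le_total_ultrafilter (F : Ultrafilter ℕ) (x y : ℕ → ℕ) :
    {n | x n ≤ y n} ∈ F ∨ {n | y n ≤ x n} ∈ F := by
  rw [← Ultrafilter.union_mem_iff]
  exact mem_of_superset univ_mem fun n _ => le_total (x n) (y n)

theorem le_trans_ultrafilter (F : Ultrafilter ℕ) (x y z : ℕ → ℕ) (h : {n | x n ≤ y n} ∈ F)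
    (h' : {n | y n ≤ z n} ∈ F) : {n | x n ≤ z n} ∈ F := by
  filter_upwards [h, h'] with n h1 h2 using h1.trans h2

/-- Both `𝔟(F)` and `𝔮(F)` are cofinalities of total preorders along which `X` is the increasing
union of `[F]`-Menger sets, so both are equal to the least length of a chain. -/
theorem ScaledNets.sInf_chainLengths {X : Type u} [Monoid X] [TopologicalSpace X]
    (s : ScaledNets X) {F : Ultrafilter ℕ} (hF : IsFree F) {𝒮 : Set (Set X)} (h𝒮 : Set.univ ∉ 𝒮)
    (hne : (chainLengths 𝒮 {H | IsFMenger (F : Filter ℕ) H}).Nonempty) :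
    sInf (chainLengths 𝒮 {H | IsFMenger (F : Filter ℕ) H}) = (Cardinal.lift.{u} (b F)).ord ∧
      b F = q F := by
  have h1 := isLeast_chainLengths h𝒮 (r := fun x y : ℕ → ℕ => {n | x n ≤ y n} ∈ F)
    (le_total_ultrafilter F) (le_trans_ultrafilter F) (fun G => s.cellSet F id G)
    (fun G G' h => s.cellSet_mono (Eventually.of_forall fun _ => le_rfl) h)
    (fun G => s.isFMenger_cellSet hF tendsto_id G) s.exists_mem_cellSet_id hne
  have h2 := isLeast_chainLengths h𝒮
    (r := fun x y : {φ // IsMonoSurj φ} => {n | y.1 n ≤ x.1 n} ∈ F)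
    (fun x y => le_total_ultrafilter F y.1 x.1)
    (fun x y z h h' => le_trans_ultrafilter F z.1 y.1 x.1 h' h)
    (fun φ => s.cellSet F φ.1 id)
    (fun φ φ' h => s.cellSet_mono h (Eventually.of_forall fun _ => le_rfl))
    (fun φ => s.isFMenger_cellSet hF φ.2.tendsto id)
    (fun x => by
      obtain ⟨φ, hφ, h⟩ := s.exists_mem_cellSet_isMonoSurj hF x
      exact ⟨⟨φ, hφ⟩, h⟩) hne
  rw [← b_eq_relCof] at h1
  rw [← q_eq_relCof] at h2
  refine ⟨h1.isGLB.csInf_eq hne, ?_⟩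
  exact Cardinal.lift_injective (Cardinal.ord_injective (h1.unique h2))

/-! ### Submonoids and subgroups generated by `[F]`-Menger sets -/

namespace ScaledNets

variable {X : Type u} [Monoid X] [TopologicalSpace X] (s : ScaledNets X) {F : Ultrafilter ℕ}

/-- A family of sets that increases along `≤_F`; if `F` is not coherent to a `Q`-point it is cofinal
in the `[F]`-Menger sets. The single parameter `y` bounds both the sizes of the finite sets and the
slowness of the monotone surjections. -/
def tower (F : Ultrafilter ℕ) (y : ℕ → ℕ) : Set X :=
  {x | ∃ t, StrictMono t ∧ (∀ᶠ n in (F : Filter ℕ), t n ≤ y n) ∧ x ∈ s.cellSet F (intervalIndex t) y}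

theorem tower_mono {y y' : ℕ → ℕ} (h : {n | y n ≤ y' n} ∈ F) : s.tower F y ⊆ s.tower F y' := by
  rintro x ⟨t, ht, hty, hx⟩
  exact ⟨t, ht, (hty.and h).mono fun n hn => hn.1.trans hn.2,
    s.cellSet_mono (Eventually.of_forall fun _ => le_rfl) h hx⟩

theorem exists_subset_tower {H : Set X} (h : IsFMenger (F : Filter ℕ) H) :
    ∃ y, H ⊆ s.tower F y := by
  obtain ⟨φ, G, hφ, hH⟩ := s.subset_cellSet_of_isFMenger h
  obtain ⟨t, ht, hle⟩ := hφ.exists_intervalIndex_le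
  exact ⟨fun n => max (t n) (G n), fun x hx => ⟨t, ht, Eventually.of_forall fun n => le_max_left _ _,
    s.cellSet_mono (Eventually.of_forall hle) (Eventually.of_forall fun n => le_max_right _ _)
      (hH hx)⟩⟩

theorem exists_mem_tower (x : X) : ∃ y, x ∈ s.tower F y := by
  obtain ⟨G, hG⟩ := s.exists_mem_cellSet_id (F := F) x
  refine ⟨fun n => max n (G n), id, strictMono_id, Eventually.of_forall fun n => le_max_left _ _,
    s.cellSet_mono (Eventually.of_forall fun n => ?_)
      (Eventually.of_forall fun n => le_max_right _ _) hG⟩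
  exact Nat.findGreatest_le n

/-- If `z` is a gap bound for a sequence above `y`, all the surjections that occur in `tower F y` lie
above the interval index of `z`, almost everywhere. -/
theorem exists_tower_subset_cellSet (hF : IsFree F)
    (hQ : ∀ L : Ultrafilter ℕ, IsQPoint L → ¬ Coherent F L)
    (y : ℕ → ℕ) :
    ∃ φ G, IsMonoSurj φ ∧ Monotone G ∧ s.tower F y ⊆ s.cellSet F φ G := by
  obtain ⟨x, hx, hyx⟩ := exists_strictMono_ge y
  obtain ⟨z, hz, hgap⟩ := exists_gap_bound hF hQ hx
  refine ⟨intervalIndex z, x, isMonoSurj_intervalIndex hz, hx.monotone, ?_⟩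
  rintro a ⟨t, ht, hty, ha⟩
  refine s.cellSet_mono ((hgap _ hty).mono fun N hN => ?_) (Eventually.of_forall hyx) ha
  obtain ⟨n, hn, h1, h2⟩ := hN
  have h3 : n ≤ intervalIndex t N := le_intervalIndex ht ((hn.trans (hyx n)).trans h1.le)
  have h4 : intervalIndex z N ≤ n := by
    by_contra! h
    exact absurd ((hz h).le.trans (apply_le_of_le_intervalIndex hz (by omega) le_rfl)) (not_le.2 h2)
  exact h4.trans h3

theorem isFMenger_tower (hF : IsFree F)
    (hQ : ∀ L : Ultrafilter ℕ, IsQPoint L → ¬ Coherent F L)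
    (y : ℕ → ℕ) : IsFMenger (F : Filter ℕ) (s.tower F y) := by
  obtain ⟨φ, G, hφ, -, h⟩ := s.exists_tower_subset_cellSet hF hQ y
  exact (s.isFMenger_cellSet hF hφ.tendsto G).mono h

/-- Countably many functions are bounded modulo `F` by their diagonal supremum. -/
theorem isFMenger_iUnion (s : ScaledNets X) (hF : IsFree F)
    (hQ : ∀ L : Ultrafilter ℕ, IsQPoint L → ¬ Coherent F L)
    {H : ℕ → Set X} (h : ∀ k, IsFMenger (F : Filter ℕ) (H k)) :
    IsFMenger (F : Filter ℕ) (⋃ k, H k) := by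
  choose y hy using fun k => s.exists_subset_tower (h k)
  refine (s.isFMenger_tower hF hQ fun n => (Finset.range (n + 1)).sup fun k => y k n).mono ?_
  refine Set.iUnion_subset fun k => (hy k).trans (s.tower_mono ?_)
  refine hF.le_atTop (eventually_atTop.2 ⟨k, fun n hn => ?_⟩)
  exact Finset.le_sup (f := fun k => y k n) (Finset.mem_range.2 (by omega))

theorem isFMenger_union (s : ScaledNets X) (hF : IsFree F)
    (hQ : ∀ L : Ultrafilter ℕ, IsQPoint L → ¬ Coherent F L)
    {H H' : Set X} (h : IsFMenger (F : Filter ℕ) H)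
    (h' : IsFMenger (F : Filter ℕ) H') : IsFMenger (F : Filter ℕ) (H ∪ H') := by
  refine (s.isFMenger_iUnion hF hQ (H := fun k => if k = 0 then H else H') fun k => ?_).mono ?_
  · split_ifs <;> assumption
  · refine Set.union_subset (Set.subset_iUnion_of_subset 0 ?_) (Set.subset_iUnion_of_subset 1 ?_)
    · simp
    · simp

/-- Products of two elements of an `[F]`-Menger set. In a product `a * b` one factor has to be
approximated at a scale that depends on the approximation of the other one. Since large sets have
bounded gaps in the sense of `exists_gap_bound`, the scale `N` can be used for one factor and some
`n < N` for the other, with `N` bounded in terms of `n` and still large enough for the balanced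
points to be moved past the neighbourhood. -/
theorem isFMenger_cellSet_mul (hF : IsFree F)
    (hQ : ∀ L : Ultrafilter ℕ, IsQPoint L → ¬ Coherent F L)
    {φ G : ℕ → ℕ} (hφ : IsMonoSurj φ) (hG : Monotone G) :
    IsFMenger (F : Filter ℕ) (s.cellSet F φ G * s.cellSet F φ G) := by
  -- the scale `h n` at which neighbourhoods can be moved past the points used at scale `n`
  have hex : ∀ n, ∀ᶠ m in atTop, (∀ i ≤ G n, s.B (φ m) * {s.cL i} ⊆ {s.cL i} * s.B (φ n)) ∧
      ∀ i ≤ G n, {s.cR i} * s.B (φ m) ⊆ s.B (φ n) * {s.cR i} := by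
    intro n
    refine Eventually.and ?_ ?_
    · refine (Set.finite_Iic (G n)).eventually_all.2 fun i _ => ?_
      obtain ⟨V, hV, hVi⟩ := s.cL_balanced i _ (s.basis.mem (φ n))
      filter_upwards [hφ.tendsto.eventually (s.basis.eventually_subset hV)] with m hm
      exact (Set.mul_subset_mul_right hm).trans hVi
    · refine (Set.finite_Iic (G n)).eventually_all.2 fun i _ => ?_
      obtain ⟨V, hV, hVi⟩ := s.cR_balanced i _ (s.basis.mem (φ n))
      filter_upwards [hφ.tendsto.eventually (s.basis.eventually_subset hV)] with m hm
      exact (Set.mul_subset_mul_left hm).trans hVi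
  obtain ⟨h, hh, hmove⟩ := exists_strictMono_eventually hex
  obtain ⟨z, hz, hgap⟩ := exists_gap_bound hF hQ hh
  set PL : ℕ → Set X := fun N => s.cL '' Set.Iic (G N)
  set PR : ℕ → Set X := fun N => s.cR '' Set.Iic (G N)
  have hPL : ∀ N, (PL N).Finite := fun N => (Set.finite_Iic _).image _
  have hPR : ∀ N, (PR N).Finite := fun N => (Set.finite_Iic _).image _
  have hM : Tendsto (fun N => φ (intervalIndex z N) - 1) atTop atTop :=
    (tendsto_sub_atTop_nat 1).comp (hφ.tendsto.comp (isMonoSurj_intervalIndex hz).tendsto)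
  refine isFMenger_of_eventually hF.le_atTop s.basis (P := fun N => PL N * PL N ∪ PR N * PR N)
    (fun N => ((hPL N).mul (hPL N)).union ((hPR N).mul (hPR N))) hM ?_
  rintro _ ⟨a, ha, b, hb, rfl⟩
  have hzt := hF.le_atTop
    ((hφ.tendsto.comp (isMonoSurj_intervalIndex hz).tendsto).eventually_ge_atTop 1)
  filter_upwards [ha, hb, hgap _ (ha.and hb), hzt] with N haN hbN ⟨n, ⟨han, hbn⟩, h1, h2⟩ h1N
  have hnN : n ≤ N := (hh.le_apply.trans h1.le)
  have hzn : intervalIndex z N ≤ n := by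
    by_contra! hlt
    exact absurd ((hz hlt).le.trans (apply_le_of_le_intervalIndex hz (by omega) le_rfl))
      (not_le.2 h2)
  have hGn : Set.Iic (G n) ⊆ Set.Iic (G N) := Set.Iic_subset_Iic.2 (hG hnN)
  have hBh : s.B (φ N) ⊆ s.B (φ (h n)) := s.basis.antitone (hφ.1 h1.le)
  have hBB : ∀ v ∈ s.B (φ n), ∀ w ∈ s.B (φ n), v * w ∈ s.B (φ (intervalIndex z N) - 1) := by
    intro v hv w hw
    have hle : φ (intervalIndex z N) - 1 + 1 ≤ φ n := by
      have := hφ.1 hzn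
      simp only [Function.comp_apply] at h1N
      omega
    exact s.mul_subset _ ⟨v, s.basis.antitone hle hv, w, s.basis.antitone hle hw, rfl⟩
  constructor
  · obtain ⟨_, ⟨i, hi, rfl⟩, v, hv, rfl⟩ := haN.1
    obtain ⟨_, ⟨j, hj, rfl⟩, w, hw, rfl⟩ := hbn.1
    obtain ⟨_, rfl, v', hv', hvv⟩ := (hmove n).1 j hj ⟨v, hBh hv, s.cL j, rfl, rfl⟩
    refine ⟨s.cL i * s.cL j, Or.inl ⟨_, ⟨i, hi, rfl⟩, _, ⟨j, hGn hj, rfl⟩, rfl⟩, v' * w,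
      hBB _ hv' _ hw, ?_⟩
    simp only at hvv ⊢
    rw [mul_assoc, ← mul_assoc (s.cL j), hvv]
    simp only [mul_assoc]
  · obtain ⟨v, hv, _, ⟨i, hi, rfl⟩, rfl⟩ := han.2
    obtain ⟨w, hw, _, ⟨j, hj, rfl⟩, rfl⟩ := hbN.2
    obtain ⟨w', hw', _, rfl, hww⟩ := (hmove n).2 i hi ⟨s.cR i, rfl, w, hBh hw, rfl⟩
    refine ⟨v * w', hBB _ hv _ hw', s.cR i * s.cR j,
      Or.inr ⟨_, ⟨i, hGn hi, rfl⟩, _, ⟨j, hj, rfl⟩, rfl⟩, ?_⟩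
    simp only at hww ⊢
    rw [mul_assoc v, ← mul_assoc w', hww]
    simp only [mul_assoc]

theorem isFMenger_mul (s : ScaledNets X) (hF : IsFree F)
    (hQ : ∀ L : Ultrafilter ℕ, IsQPoint L → ¬ Coherent F L)
    {H H' : Set X} (h : IsFMenger (F : Filter ℕ) H)
    (h' : IsFMenger (F : Filter ℕ) H') : IsFMenger (F : Filter ℕ) (H * H') := by
  obtain ⟨y, hy⟩ := s.exists_subset_tower (s.isFMenger_union hF hQ h h')
  obtain ⟨φ, G, hφ, hG, hsub⟩ := s.exists_tower_subset_cellSet hF hQ y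
  have hs := hy.trans hsub
  exact (s.isFMenger_cellSet_mul hF hQ hφ hG).mono (Set.mul_subset_mul
    (Set.subset_union_left.trans hs) (Set.subset_union_right.trans hs))

theorem isFMenger_submonoidClosure (s : ScaledNets X) (hF : IsFree F)
    (hQ : ∀ L : Ultrafilter ℕ, IsQPoint L → ¬ Coherent F L)
    {H : Set X} (h : IsFMenger (F : Filter ℕ) H) :
    IsFMenger (F : Filter ℕ) (Submonoid.closure H : Set X) := by
  have h1 : IsFMenger (F : Filter ℕ) ({1} : Set X) := by
    obtain ⟨G, hG⟩ := s.exists_mem_cellSet_id (F := F) 1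
    exact (s.isFMenger_cellSet hF tendsto_id G).mono (Set.singleton_subset_iff.2 hG)
  have hpow : ∀ k : ℕ, IsFMenger (F : Filter ℕ) (H ^ k) := fun k => by
    induction k with
    | zero => simpa [← Set.singleton_one] using h1
    | succ k ih =>
      rw [pow_succ]
      exact s.isFMenger_mul hF hQ ih h
  refine (s.isFMenger_iUnion hF hQ hpow).mono fun x hx => ?_
  induction hx using Submonoid.closure_induction with
  | mem x hx => exact Set.mem_iUnion.2 ⟨1, by simpa using hx⟩
  | one => exact Set.mem_iUnion.2 ⟨0, by simp⟩
  | mul x y _ _ hx hy =>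
    obtain ⟨k, hk⟩ := Set.mem_iUnion.1 hx
    obtain ⟨l, hl⟩ := Set.mem_iUnion.1 hy
    exact Set.mem_iUnion.2 ⟨k + l, pow_add H k l ▸ Set.mul_mem_mul hk hl⟩

end ScaledNets

theorem cfMonoid_of_exists {X : Type u} [Monoid X] [TopologicalSpace X] (s : ScaledNets X)
    {F : Ultrafilter ℕ} (hF : IsFree F) (h : CfMonoidExists X F) :
    cfMonoid X F = (Cardinal.lift.{u} (b F)).ord ∧ b F = q F := by
  rw [CfMonoidExists, submonoidChainLengths_eq] at h
  rw [cfMonoid, submonoidChainLengths_eq]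
  exact s.sInf_chainLengths hF (fun h => h.1 rfl) h

theorem cfGroup_of_exists {X : Type u} [Group X] [TopologicalSpace X] (s : ScaledNets X)
    {F : Ultrafilter ℕ} (hF : IsFree F) (h : CfGroupExists X F) :
    cfGroup X F = (Cardinal.lift.{u} (b F)).ord ∧ b F = q F := by
  rw [CfGroupExists, subgroupChainLengths_eq] at h
  rw [cfGroup, subgroupChainLengths_eq]
  exact s.sInf_chainLengths hF (fun h => h.1 rfl) h

theorem cfMonoidExists_of_not_coherent {X : Type u} [Monoid X] [TopologicalSpace X]
    (s : ScaledNets X) {F : Ultrafilter ℕ} (hF : IsFree F)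
    (hQ : ∀ L : Ultrafilter ℕ, IsQPoint L → ¬ Coherent F L)
    (hX : ∃ k : ℕ, ¬ IsMengerMonoid (Fin k → X)) : CfMonoidExists X F := by
  rw [CfMonoidExists, submonoidChainLengths_eq]
  refine ⟨_, ord_relCof_mem_chainLengths (le_total_ultrafilter F) (le_trans_ultrafilter F)
    (fun y => (Submonoid.closure (s.tower F y) : Set X))
    (fun y y' h => Submonoid.closure_mono (s.tower_mono h)) (fun y => ⟨fun h => ?_, _, rfl⟩)
    (fun x => ?_) fun H hH => ?_⟩
  · obtain ⟨k, hk⟩ := hX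
    refine hk (isMengerMonoid_pi_of_isFMenger_univ F ?_ k)
    rw [← h]
    exact s.isFMenger_submonoidClosure hF hQ (s.isFMenger_tower hF hQ y)
  · obtain ⟨y, hy⟩ := s.exists_mem_tower x
    exact ⟨y, Submonoid.subset_closure hy⟩
  · obtain ⟨y, hy⟩ := s.exists_subset_tower hH
    exact ⟨y, hy.trans Submonoid.subset_closure⟩

section Groups

variable {X : Type u} [Group X] [TopologicalSpace X] [IsTopologicalGroup X]

theorem isBalanced_of_group : IsBalanced X := by
  have hconj : ∀ x : X, ∀ U ∈ 𝓝 (1 : X), {v | x * v * x⁻¹ ∈ U} ∈ 𝓝 (1 : X) := fun x U hU => by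
    have : Continuous fun v : X => x * v * x⁻¹ := by fun_prop
    exact this.continuousAt.preimage_mem_nhds (by simpa using hU)
  have hL : leftBalancedPoints X = Set.univ := Set.eq_univ_of_forall fun x U hU => by
    refine ⟨_, hconj x⁻¹ U hU, ?_⟩
    rintro _ ⟨v, hv, x', hx', rfl⟩
    obtain rfl : x' = x := hx'
    refine ⟨x', rfl, x'⁻¹ * v * x', by simpa using hv, by simp [mul_assoc]⟩
  have hR : rightBalancedPoints X = Set.univ := Set.eq_univ_of_forall fun x U hU => by
    refine ⟨_, hconj x U hU, ?_⟩
    rintro _ ⟨x', hx', v, hv, rfl⟩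
    obtain rfl : x' = x := hx'
    exact ⟨x' * v * x'⁻¹, hv, x', rfl, by simp [mul_assoc]⟩
  rw [IsBalanced, hL, hR]
  refine ⟨fun U hU => ?_, fun U hU => ?_⟩
  · exact Set.univ_mul_of_one_mem (mem_of_mem_nhds hU)
  · exact Set.mul_univ_of_one_mem (mem_of_mem_nhds hU)

theorem isTwoSidedOmegaBounded_of_group (h : IsOmegaBounded X) : IsTwoSidedOmegaBounded X := by
  intro U hU
  obtain ⟨C, hC, hCU⟩ := h U hU
  obtain ⟨D, hD, hDU⟩ := h U⁻¹ (inv_mem_nhds_one X hU)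
  refine ⟨C ∪ D⁻¹, hC.union (hD.preimage inv_injective), ?_, ?_⟩
  · exact Set.eq_univ_of_univ_subset (hCU ▸ Set.mul_subset_mul_right Set.subset_union_left)
  · refine Set.eq_univ_of_univ_subset ?_
    calc Set.univ = (D * U⁻¹)⁻¹ := by rw [hDU, Set.inv_univ]
      _ = U * D⁻¹ := by rw [mul_inv_rev, inv_inv]
      _ ⊆ U * (C ∪ D⁻¹) := Set.mul_subset_mul_left Set.subset_union_right

theorem isOmegaBounded_of_separable [TopologicalSpace.SeparableSpace X] : IsOmegaBounded X := by
  intro U hU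
  obtain ⟨C, hC, hCd⟩ := TopologicalSpace.exists_countable_dense X
  refine ⟨C, hC, Set.eq_univ_of_forall fun x => ?_⟩
  have hcont : Continuous fun c : X => c⁻¹ * x := by fun_prop
  obtain ⟨c, hc, hcU⟩ := hCd.inter_nhds_nonempty
    (hcont.continuousAt.preimage_mem_nhds (x := x) (t := U) (by simpa using hU))
  exact ⟨c, hc, c⁻¹ * x, hcU, by simp⟩

theorem nonempty_scaledNets_of_group [FirstCountableTopology X] (h : IsOmegaBounded X) :
    Nonempty (ScaledNets X) :=
  nonempty_scaledNets (isTwoSidedOmegaBounded_of_group h) isBalanced_of_group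

theorem IsFMenger.inv {F : Filter ℕ} {H : Set X} (h : IsFMenger F H) : IsFMenger F H⁻¹ := by
  intro U hU
  obtain ⟨E, hE, φ, hφ, hsub⟩ := h (fun n => (U n)⁻¹) fun n => inv_mem_nhds_one X (hU n)
  refine ⟨fun n => (E n)⁻¹, fun n => (hE n).inv, φ, hφ, fun x hx => ?_⟩
  obtain ⟨A, hA, hxA⟩ := Set.mem_iUnion₂.1 (hsub (Set.mem_inv.1 hx))
  refine Set.mem_iUnion₂.2 ⟨A, hA, Set.mem_iInter₂.2 fun n hn => ?_⟩
  obtain ⟨h1, h2⟩ := Set.mem_iInter₂.1 hxA n hn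
  rw [← Set.mem_inv, mul_inv_rev, inv_inv] at h1 h2
  exact ⟨h2, h1⟩

theorem cfGroupExists_of_not_coherent (s : ScaledNets X) {F : Ultrafilter ℕ} (hF : IsFree F)
    (hQ : ∀ L : Ultrafilter ℕ, IsQPoint L → ¬ Coherent F L)
    (hX : ∃ k : ℕ, ¬ IsMengerMonoid (Fin k → X)) : CfGroupExists X F := by
  rw [CfGroupExists, subgroupChainLengths_eq]
  refine ⟨_, ord_relCof_mem_chainLengths (le_total_ultrafilter F) (le_trans_ultrafilter F)
    (fun y => (Subgroup.closure (s.tower F y) : Set X))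
    (fun y y' h => Subgroup.closure_mono (s.tower_mono h)) (fun y => ⟨fun h => ?_, _, rfl⟩)
    (fun x => ?_) fun H hH => ?_⟩
  · obtain ⟨k, hk⟩ := hX
    refine hk (isMengerMonoid_pi_of_isFMenger_univ F ?_ k)
    have hT := s.isFMenger_tower hF hQ y
    rw [← h, ← Subgroup.coe_toSubmonoid, Subgroup.closure_toSubmonoid]
    exact s.isFMenger_submonoidClosure hF hQ (s.isFMenger_union hF hQ hT hT.inv)
  · obtain ⟨y, hy⟩ := s.exists_mem_tower x
    exact ⟨y, Subgroup.subset_closure hy⟩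
  · obtain ⟨y, hy⟩ := s.exists_subset_tower hH
    exact ⟨y, hy.trans Subgroup.subset_closure⟩

end Groups

/-! ### Roelcke precompact Polish groups and `Q`-points -/

/-- A category argument along a sparse ultrafilter: if `O n` are open sets that eventually meet each
given nonempty open set, then some point lies in `O n` for almost all `n`. At stage `n` only finitely
many basic open sets can be current, so that a sparse set leaves room to wait, after each stage,
until `O` meets the next one. -/
theorem exists_eventually_mem_of_sparse {Y : Type*} [TopologicalSpace Y] [PolishSpace Y] [Nonempty Y]
    {G : Ultrafilter ℕ} (hG : (G : Filter ℕ) ≤ atTop)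
    (hsp : ∀ θ : ℕ → ℕ, ∃ A ∈ G, ∀ n ∈ A, ∀ m ∈ A, n < m → θ n ≤ m)
    {O : ℕ → Set Y} (hO : ∀ n, IsOpen (O n))
    (hd : ∀ W : Set Y, IsOpen W → W.Nonempty → ∀ᶠ n in atTop, (W ∩ O n).Nonempty) :
    ∃ p, ∀ᶠ n in (G : Filter ℕ), p ∈ O n := by
  let _ := TopologicalSpace.upgradeIsCompletelyMetrizable Y
  have hbasis := TopologicalSpace.isBasis_countableBasis Y
  obtain ⟨W, hW⟩ : ∃ W : ℕ → Set Y, TopologicalSpace.countableBasis Y = Set.range W := by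
    refine (TopologicalSpace.countable_countableBasis Y).exists_eq_range ?_
    obtain ⟨V, hV, -⟩ := hbasis.exists_subset_of_mem_open (Set.mem_univ (Classical.arbitrary Y))
      isOpen_univ
    exact ⟨V, hV⟩
  have hWo : ∀ i, IsOpen (W i) := fun i => hbasis.isOpen (hW ▸ Set.mem_range_self i)
  have hWn : ∀ i, (W i).Nonempty := fun i =>
    TopologicalSpace.nonempty_of_mem_countableBasis (hW ▸ Set.mem_range_self i)
  have hstep : ∀ n i, ∃ j, (W i ∩ O n).Nonempty → closure (W j) ⊆ W i ∩ O n ∧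
      Bornology.IsBounded (closure (W j)) ∧ Metric.diam (closure (W j)) ≤ 2 * (1 / ((n : ℝ) + 1)) := by
    intro n i
    by_cases h : (W i ∩ O n).Nonempty
    · obtain ⟨p, hp⟩ := h
      obtain ⟨ε, hε, hsub⟩ := Metric.nhds_basis_closedBall.mem_iff.1
        (((hWo i).inter (hO n)).mem_nhds hp)
      set δ := min ε (1 / ((n : ℝ) + 1)) with hδ
      have hδ0 : 0 < δ := lt_min hε (by positivity)
      obtain ⟨V, hV, -, hVs⟩ := hbasis.exists_subset_of_mem_open (Metric.mem_ball_self hδ0)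
        (Metric.isOpen_ball (x := p))
      obtain ⟨j, rfl⟩ : V ∈ Set.range W := hW ▸ hV
      have hcl : closure (W j) ⊆ Metric.closedBall p δ :=
        (closure_mono hVs).trans Metric.closure_ball_subset_closedBall
      refine ⟨j, fun _ => ⟨?_, Metric.isBounded_closedBall.subset hcl, ?_⟩⟩
      · exact hcl.trans ((Metric.closedBall_subset_closedBall (min_le_left _ _)).trans hsub)
      · calc Metric.diam (closure (W j)) ≤ Metric.diam (Metric.closedBall p δ) :=
              Metric.diam_mono hcl Metric.isBounded_closedBall
          _ ≤ 2 * δ := Metric.diam_closedBall hδ0.le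
          _ ≤ _ := by gcongr; exact min_le_right _ _
    · exact ⟨0, fun h' => absurd h' h⟩
  choose j hj using hstep
  choose τ hτ using fun i => eventually_atTop.1 (hd (W i) (hWo i) (hWn i))
  obtain ⟨A, hA, hsparse⟩ := hsp fun n =>
    (Finset.range (n + 1)).sup fun i => max (j n i) (τ (j n i))
  have hbound : ∀ n ∈ A, ∀ m ∈ A, n < m → ∀ i ≤ n, j n i ≤ m ∧ τ (j n i) ≤ m := by
    intro n hn m hm hnm i hi
    have h1 := (Finset.le_sup (f := fun i => max (j n i) (τ (j n i)))
      (Finset.mem_range.2 (Nat.lt_succ_of_le hi))).trans (hsparse n hn m hm hnm)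
    exact ⟨(le_max_left _ _).trans h1, (le_max_right _ _).trans h1⟩
  set A' := A ∩ Set.Ici (τ 0) with hA'
  have hA'G : A' ∈ G := inter_mem hA (hG (Ici_mem_atTop _))
  have hinf : A'.Infinite := by
    refine (Nat.frequently_atTop_iff_infinite (p := (· ∈ A'))).1 ?_
    exact (Eventually.frequently (f := (G : Filter ℕ)) hA'G).filter_mono hG
  set e : ℕ → ℕ := Nat.nth (· ∈ A') with he
  have hem : StrictMono e := Nat.nth_strictMono hinf
  have heA : ∀ k, e k ∈ A' := fun k => Nat.nth_mem_of_infinite hinf k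
  let i : ℕ → ℕ := fun k => Nat.rec 0 (fun k a => j (e k) a) k
  have hi1 : ∀ k, i (k + 1) = j (e k) (i k) := fun k => rfl
  have hinv : ∀ k, i k ≤ e k ∧ τ (i k) ≤ e k := by
    intro k
    induction k with
    | zero => exact ⟨Nat.zero_le _, (heA 0).2⟩
    | succ k ih =>
      rw [hi1]
      exact hbound _ (heA k).1 _ (heA (k + 1)).1 (hem k.lt_succ_self) _ ih.1
  have hK := fun k => hj (e k) (i k) (hτ _ _ (hinv k).2)
  simp only [← hi1] at hK
  have hanti : Antitone fun k => closure (W (i (k + 1))) :=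
    antitone_nat_of_succ_le fun k => ((hK (k + 1)).1.trans Set.inter_subset_left).trans subset_closure
  obtain ⟨p, hp⟩ := Metric.nonempty_iInter_of_nonempty_biInter
    (s := fun k => closure (W (i (k + 1)))) (fun k => isClosed_closure) (fun k => (hK k).2.1)
    (fun N => by
      obtain ⟨q, hq⟩ := hWn (i (N + 1))
      exact ⟨q, Set.mem_iInter₂.2 fun k hk => hanti hk (subset_closure hq)⟩)
    (by
      have h1 : Tendsto (fun k => 2 * (1 / ((e k : ℝ) + 1))) atTop (𝓝 (2 * 0)) :=
        (tendsto_one_div_add_atTop_nhds_zero_nat.comp hem.tendsto_atTop).const_mul 2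
      rw [mul_zero] at h1
      exact squeeze_zero (fun k => Metric.diam_nonneg) (fun k => (hK k).2.2) h1)
  refine ⟨p, mem_of_superset hA'G fun n hn => ?_⟩
  obtain ⟨k, rfl⟩ : n ∈ Set.range e :=
    (Nat.range_nth_of_infinite (p := (· ∈ A')) hinf).ge hn
  exact ((hK k).1 (Set.mem_iInter.1 hp k)).2

/-- A Roelcke precompact Polish group is a product of three copies of an `[F]`-Menger set, if `F` is
coherent to a `Q`-point. A given `g` is factored as `x * y * z` by the category argument in the space
of pairs `(x, z)`: if `x` and `z` are points `a`, `b` of a dense sequence then `y = a⁻¹ * g * b⁻¹` is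
close to a finite set `E` after a small change, as `y = u * e * v` with `e ∈ E` and `u`, `v` near
`1`, and `u`, `v` can be absorbed into the other two factors. -/
theorem exists_isFMenger_mul_mul_eq_univ {X : Type u} [Group X] [TopologicalSpace X]
    [IsTopologicalGroup X] [PolishSpace X]
    (hR : ∀ U ∈ 𝓝 (1 : X), ∃ E : Set X, E.Finite ∧ U * E * U = Set.univ)
    {F L : Ultrafilter ℕ} (hF : IsFree F) (hL : IsQPoint L) (hFL : Coherent F L) :
    ∃ H : Set X, IsFMenger (F : Filter ℕ) H ∧ H * H * H = Set.univ := by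
  obtain ⟨φ, hφ, hsp⟩ := exists_sparse_map_of_coherent hL hFL
  obtain ⟨B, hB⟩ := (𝓝 (1 : X)).exists_antitone_basis
  set c := TopologicalSpace.denseSeq X with hc
  have hint : ∀ n, interior (B n) ∈ 𝓝 (1 : X) := fun n => interior_mem_nhds.2 (hB.mem n)
  -- neighbourhoods that can be moved past the first points of the dense sequence
  have hU : ∀ n, ∃ U ∈ 𝓝 (1 : X), U ⊆ interior (B n) ∧
      ∀ j ≤ n, ∀ u ∈ U, c j * u * (c j)⁻¹ ∈ interior (B n) ∧ (c j)⁻¹ * u * c j ∈ interior (B n) := by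
    intro n
    refine ⟨interior (B n) ∩ ⋂ j ∈ Set.Iic n, {u | c j * u * (c j)⁻¹ ∈ interior (B n) ∧
      (c j)⁻¹ * u * c j ∈ interior (B n)}, inter_mem (hint n) ?_, Set.inter_subset_left,
      fun j hj u hu => Set.mem_iInter₂.1 hu.2 j hj⟩
    refine (biInter_mem (Set.finite_Iic n)).2 fun j _ => ?_
    have h1 : Continuous fun u : X => c j * u * (c j)⁻¹ := by fun_prop
    have h2 : Continuous fun u : X => (c j)⁻¹ * u * c j := by fun_prop
    have h3 := h1.continuousAt.preimage_mem_nhds (x := 1) (t := interior (B n))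
      (by simpa using hB.mem n)
    have h4 := h2.continuousAt.preimage_mem_nhds (x := 1) (t := interior (B n))
      (by simpa using hB.mem n)
    filter_upwards [h3, h4] with u hu hu' using ⟨hu, hu'⟩
  choose U hU1 hUB hUc using hU
  choose E hE hUEU using fun n => hR (U n) (hU1 n)
  set P : ℕ → Set X := fun n => c '' Set.Iic n ∪ E n with hP
  set Q : ℕ → Set X := fun n => (P n * interior (B n)) ∩ (interior (B n) * P n) with hQ
  have hQo : ∀ n, IsOpen (Q n) := fun n =>
    (isOpen_interior.mul_left).inter (isOpen_interior.mul_right)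
  refine ⟨{x | ∀ᶠ N in (F : Filter ℕ), x ∈ Q (φ N)}, ?_, ?_⟩
  · refine isFMenger_of_eventually hF.le_atTop hB (P := fun N => P (φ N))
      (fun N => ((Set.finite_Iic _).image _).union (hE _)) hφ.tendsto fun x hx => ?_
    refine Eventually.mono hx fun N hN => ?_
    exact ⟨Set.mul_subset_mul_left interior_subset hN.1,
      Set.mul_subset_mul_right interior_subset hN.2⟩
  refine Set.eq_univ_of_forall fun g => ?_
  have hcont : Continuous fun w : X × X => w.1⁻¹ * g * w.2⁻¹ := by fun_prop
  obtain ⟨⟨x, z⟩, hxz⟩ := exists_eventually_mem_of_sparse (Y := X × X) (G := F.map φ)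
    (O := fun n => {w | w.1 ∈ Q n ∧ w.1⁻¹ * g * w.2⁻¹ ∈ Q n ∧ w.2 ∈ Q n})
    (hφ.tendsto.mono_left hF.le_atTop) hsp
    (fun n => ((hQo n).preimage continuous_fst).inter
      (((hQo n).preimage hcont).inter ((hQo n).preimage continuous_snd))) (by
    intro W hW hWne
    obtain ⟨⟨k, l⟩, hkl⟩ := ((TopologicalSpace.denseRange_denseSeq X).prodMap
      (TopologicalSpace.denseRange_denseSeq X)).exists_mem_open hW hWne
    have hmul : Continuous fun w : X × X => (c k * w.1, w.2 * c l) := by fun_prop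
    have hmem : {w : X × X | (c k * w.1, w.2 * c l) ∈ W} ∈ 𝓝 ((1 : X), (1 : X)) :=
      hmul.continuousAt.preimage_mem_nhds (hW.mem_nhds (by simpa using hkl))
    obtain ⟨V₁, hV₁, V₂, hV₂, hV⟩ := mem_nhds_prod_iff.1 hmem
    filter_upwards [eventually_ge_atTop k, eventually_ge_atTop l, hB.eventually_subset hV₁,
      hB.eventually_subset hV₂] with n hkn hln hn₁ hn₂
    obtain ⟨_, ⟨u, hu, d, hd, rfl⟩, v, hv, huv⟩ :=
      (hUEU n).ge (Set.mem_univ ((c k)⁻¹ * g * (c l)⁻¹))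
    have hu' := hUB n hu
    have hv' := hUB n hv
    have hmid : (c k * u)⁻¹ * g * (v * c l)⁻¹ = d := by
      calc (c k * u)⁻¹ * g * (v * c l)⁻¹ = u⁻¹ * ((c k)⁻¹ * g * (c l)⁻¹) * v⁻¹ := by
            simp only [mul_inv_rev, mul_assoc]
        _ = d := by rw [← huv]; simp [mul_assoc]
    have h1 : (1 : X) ∈ interior (B n) := mem_of_mem_nhds (hint n)
    have hck : c k ∈ P n := Or.inl ⟨k, hkn, rfl⟩
    have hcl : c l ∈ P n := Or.inl ⟨l, hln, rfl⟩
    have hmemW : (u, v) ∈ {w : X × X | (c k * w.1, w.2 * c l) ∈ W} :=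
      hV ⟨hn₁ (interior_subset hu'), hn₂ (interior_subset hv')⟩
    refine ⟨(c k * u, v * c l), hmemW, ?_, ?_, ?_⟩
    · exact ⟨⟨_, hck, u, hu', rfl⟩, _, (hUc n k hkn u hu).1, _, hck, by simp⟩
    · show (c k * u)⁻¹ * g * (v * c l)⁻¹ ∈ Q n
      rw [hmid]
      exact ⟨⟨d, Or.inr hd, 1, h1, mul_one d⟩, 1, h1, d, Or.inr hd, one_mul d⟩
    · exact ⟨⟨_, hcl, _, (hUc n l hln v hv).2, by simp [mul_assoc]⟩, v, hv', _, hcl, rfl⟩)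
  have hev : ∀ᶠ N in (F : Filter ℕ), x ∈ Q (φ N) ∧ x⁻¹ * g * z⁻¹ ∈ Q (φ N) ∧ z ∈ Q (φ N) := hxz
  refine ⟨x * (x⁻¹ * g * z⁻¹), ⟨x, hev.mono fun _ h => h.1, _, hev.mono fun _ h => h.2.1, rfl⟩, z,
    hev.mono fun _ h => h.2.2, ?_⟩
  simp [mul_assoc]

/-- A member of a chain that contains `H` with `H * H * H = X` is not proper. -/
theorem not_cfMonoidExists_of_coherent {X : Type u} [Group X] [TopologicalSpace X]
    [IsTopologicalGroup X] [PolishSpace X]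
    (hR : ∀ U ∈ 𝓝 (1 : X), ∃ E : Set X, E.Finite ∧ U * E * U = Set.univ)
    {F L : Ultrafilter ℕ} (hF : IsFree F) (hL : IsQPoint L) (hFL : Coherent F L) :
    ¬ CfMonoidExists X F := by
  rintro ⟨lam, S, -, hne, -, hS⟩
  obtain ⟨H, hH, hHHH⟩ := exists_isFMenger_mul_mul_eq_univ hR hF hL hFL
  obtain ⟨i, hi⟩ := hS H hH
  refine hne i (eq_top_iff.2 fun g _ => ?_)
  obtain ⟨_, ⟨x, hx, y, hy, rfl⟩, z, hz, rfl⟩ := hHHH.ge (Set.mem_univ g)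
  exact mul_mem (mul_mem (hi hx) (hi hy)) (hi hz)

theorem CfGroupExists.cfMonoidExists {X : Type u} [Group X] [TopologicalSpace X] {F : Filter ℕ}
    (h : CfGroupExists X F) : CfMonoidExists X F := by
  obtain ⟨lam, S, hmono, hne, hcov, hH⟩ := h
  refine ⟨lam, fun i => (S i).toSubmonoid, fun i j hij => hmono hij, fun i hi => hne i ?_, hcov, hH⟩
  exact SetLike.coe_injective (congrArg (fun M : Submonoid X => (M : Set X)) hi)

/-! ### The homeomorphism group of the half-line -/

namespace HalfLineHomeo

theorem strictMono (h : HalfLineHomeo) : StrictMono h := by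
  rcases h.continuous.strictMono_of_inj h.injective with hm | hm
  · exact hm
  · obtain ⟨t, ht⟩ := h.surjective (h 0 + 1)
    have h1 : h t ≤ h 0 := hm.antitone (zero_le (a := t))
    rw [ht] at h1
    exact absurd h1 (not_le.2 (lt_add_one (h 0)))

theorem map_zero (h : HalfLineHomeo) : h 0 = 0 := by
  obtain ⟨t, ht⟩ := h.surjective 0
  have h1 : h 0 ≤ h t := h.strictMono.monotone zero_le
  exact le_antisymm (h1.trans ht.le) zero_le

theorem apply_inv_apply (h : HalfLineHomeo) (t : ℝ≥0) : h (h⁻¹ t) = t := h.apply_symm_apply t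

theorem inv_apply_apply (h : HalfLineHomeo) (t : ℝ≥0) : h⁻¹ (h t) = t := h.symm_apply_apply t

/-- The underlying continuous map. -/
def toCM (h : HalfLineHomeo) : C(ℝ≥0, ℝ≥0) := ⟨h, h.continuous⟩

theorem isInducing_toCM : IsInducing toCM := ⟨rfl⟩

theorem continuous_apply (t : ℝ≥0) : Continuous fun h : HalfLineHomeo => h t :=
  (continuous_eval_const (F := C(ℝ≥0, ℝ≥0)) t).comp isInducing_toCM.continuous

/-- As all the homeomorphisms are increasing, the compact-open topology is the topology of pointwise
convergence. -/
theorem isInducing_coe : IsInducing fun h : HalfLineHomeo => (h : ℝ≥0 → ℝ≥0) := by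
  refine isInducing_iff_nhds.2 fun g => le_antisymm ?_ ?_
  · exact (continuous_pi continuous_apply).continuousAt.le_comap
  rw [isInducing_toCM.nhds_eq_comap, ← tendsto_iff_comap, ContinuousMap.tendsto_nhds_compactOpen]
  intro K hK U hU hKU
  have hev : ∀ t, ∀ V ∈ 𝓝 (g t),
      ∀ᶠ h : HalfLineHomeo in comap (fun h => (h : ℝ≥0 → ℝ≥0)) (𝓝 (g : ℝ≥0 → ℝ≥0)), h t ∈ V :=
    fun t V hV =>
      (((_root_.continuous_apply (A := fun _ : ℝ≥0 => ℝ≥0) t).tendsto _).comp tendsto_comap).eventually hV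
  refine hK.induction_on (p := fun s => ∀ᶠ h in comap _ _, Set.MapsTo (toCM h) s U)
    (Eventually.of_forall fun h => Set.mapsTo_empty _ _)
    (fun s t hst ht => ht.mono fun h hh => hh.mono_left hst)
    (fun s t hs ht => (hs.and ht).mono fun h hh => hh.1.union hh.2) fun x hx => ?_
  obtain ⟨p, q, -, hpq, hpqU⟩ := exists_Icc_mem_subset_of_mem_nhds (hU.mem_nhds (hKU hx))
  obtain ⟨a, b, hxab, hab, habs⟩ := exists_Icc_mem_subset_of_mem_nhds
    (g.continuous.continuousAt.preimage_mem_nhds (eventually_mem_nhds_iff.2 hpq))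
  refine ⟨Set.Icc a b, mem_nhdsWithin_of_mem_nhds hab, ?_⟩
  have hle := hxab.1.trans hxab.2
  filter_upwards [hev a _ (habs ⟨le_rfl, hle⟩), hev b _ (habs ⟨hle, le_rfl⟩)] with h ha hb t ht
  exact hpqU ⟨ha.1.trans (h.strictMono.monotone ht.1), (h.strictMono.monotone ht.2).trans hb.2⟩

instance : ContinuousMul HalfLineHomeo where
  continuous_mul := by
    rw [isInducing_toCM.continuous_iff]
    exact ContinuousMap.continuous_comp'.comp
      ((isInducing_toCM.continuous.comp continuous_snd).prodMk
        (isInducing_toCM.continuous.comp continuous_fst))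

instance : ContinuousInv HalfLineHomeo where
  continuous_inv := by
    rw [isInducing_coe.continuous_iff]
    refine continuous_pi fun t => continuous_iff_continuousAt.2 fun g => tendsto_order.2 ⟨?_, ?_⟩
    · intro a ha
      have h1 : g a < t := g.apply_inv_apply t ▸ g.strictMono ha
      filter_upwards [(continuous_apply a).continuousAt.eventually_lt_const h1] with h hh
      exact h.strictMono.lt_iff_lt.1 ((h.apply_inv_apply t).symm ▸ hh)
    · intro a ha
      have h1 : t < g a := g.apply_inv_apply t ▸ g.strictMono ha
      filter_upwards [(continuous_apply a).continuousAt.eventually_const_lt h1] with h hh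
      exact h.strictMono.lt_iff_lt.1 ((h.apply_inv_apply t).symm ▸ hh)

instance : IsTopologicalGroup HalfLineHomeo where

/-- The group is closed in a Polish space through `h ↦ (h, h⁻¹)`. -/
instance : PolishSpace HalfLineHomeo := by
  have hcont : Continuous toCM := isInducing_toCM.continuous
  have hind : IsInducing fun h : HalfLineHomeo => (toCM h, toCM h⁻¹) := by
    have h1 : IsInducing (Prod.fst ∘ fun h : HalfLineHomeo => (toCM h, toCM h⁻¹)) := isInducing_toCM
    exact IsInducing.of_comp (hcont.prodMk (hcont.comp continuous_inv)) continuous_fst h1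
  refine IsClosedEmbedding.polishSpace (f := fun h : HalfLineHomeo => (toCM h, toCM h⁻¹))
    ⟨⟨hind, fun h g hhg => ?_⟩, ?_⟩
  · ext1 t
    exact congrArg (fun w : C(ℝ≥0, ℝ≥0) × C(ℝ≥0, ℝ≥0) => w.1 t) hhg
  · have : Set.range (fun h : HalfLineHomeo => (toCM h, toCM h⁻¹)) =
        {w | w.1.comp w.2 = ContinuousMap.id _} ∩ {w | w.2.comp w.1 = ContinuousMap.id _} := by
      ext ⟨f, g⟩
      constructor
      · rintro ⟨h, hh⟩
        obtain ⟨rfl, rfl⟩ := Prod.ext_iff.1 hh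
        exact ⟨ContinuousMap.ext fun t => h.apply_inv_apply t,
          ContinuousMap.ext fun t => h.inv_apply_apply t⟩
      · rintro ⟨h1, h2⟩
        exact ⟨⟨⟨f, g, fun t => DFunLike.congr_fun h2 t, fun t => DFunLike.congr_fun h1 t⟩,
          f.continuous, g.continuous⟩, rfl⟩
    rw [this]
    refine IsClosed.inter (isClosed_eq ?_ continuous_const) (isClosed_eq ?_ continuous_const)
    · exact ContinuousMap.continuous_comp'.comp continuous_swap
    · exact ContinuousMap.continuous_comp'

theorem exists_eq_of_strictMono {f : ℝ≥0 → ℝ≥0} (hc : Continuous f) (hm : StrictMono f)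
    (h0 : f 0 = 0) (hunb : ∀ y, ∃ x, y ≤ f x) : ∃ h : HalfLineHomeo, ∀ t, h t = f t := by
  have hs : Function.Surjective f := fun y => by
    obtain ⟨x, hx⟩ := hunb y
    obtain ⟨t, -, ht⟩ := intermediate_value_Icc (zero_le (a := x)) hc.continuousOn
      (⟨h0.trans_le zero_le, hx⟩ : y ∈ Set.Icc (f 0) (f x))
    exact ⟨t, ht⟩
  exact ⟨(hm.orderIsoOfSurjective f hs).toHomeomorph, fun t => rfl⟩

/-- Homeomorphisms of the half-line grow arbitrarily fast. -/
theorem exists_apply_nat_gt (a : ℕ → ℝ≥0) : ∃ h : HalfLineHomeo, ∀ n : ℕ, a n < h (n + 1) := by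
  set f : ℕ → ℝ≥0 → ℝ≥0 := fun n t => a n * (t - n) with hf
  have hsupp : ∀ n t, f n t ≠ 0 → (n : ℝ≥0) < t := fun n t h => by
    by_contra! hle
    exact h (by simp [hf, tsub_eq_zero_of_le hle])
  have hfin : ∀ t, (Function.support fun n => f n t).Finite := fun t => by
    refine (Set.finite_Iio (⌈t⌉₊)).subset fun n hn => ?_
    exact Nat.lt_ceil.2 (hsupp n t hn)
  have hlf : LocallyFinite fun n => Function.support (f n) := fun t => by
    refine ⟨Set.Iio (t + 1), Iio_mem_nhds (lt_add_one t), ?_⟩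
    refine (Set.finite_Iio (⌈t + 1⌉₊)).subset ?_
    rintro n ⟨x, hx, hxt⟩
    exact Nat.lt_ceil.2 ((hsupp n x hx).trans hxt)
  have hcont : Continuous fun t => t + ∑ᶠ n, f n t :=
    continuous_id.add (continuous_finsum (fun n => by fun_prop) hlf)
  have hmono : StrictMono fun t => t + ∑ᶠ n, f n t := fun s t hst =>
    add_lt_add_of_lt_of_le hst (finsum_le_finsum' (hfin s) (hfin t) fun n =>
      mul_le_mul_right (tsub_le_tsub_right hst.le _) _)
  obtain ⟨h, hh⟩ := exists_eq_of_strictMono hcont hmono (by simp [hf])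
    fun y => ⟨y, le_self_add⟩
  refine ⟨h, fun n => ?_⟩
  have h1 : f n (n + 1) ≤ ∑ᶠ m, f m (n + 1) :=
    single_le_finsum n (hfin _) fun m => zero_le
  have h2 : f n (n + 1) = a n := by simp [hf]
  rw [hh]
  calc a n ≤ ∑ᶠ m, f m (n + 1) := h2 ▸ h1
    _ < n + 1 + ∑ᶠ m, f m (n + 1) := lt_add_of_pos_left _ (by positivity)

theorem not_isMengerMonoid : ¬ IsMengerMonoid (Fin 1 → HalfLineHomeo) := by
  intro hM
  obtain ⟨E, hE, hcov⟩ := hM (fun n => {f | f 0 (n + 1) < (n : ℝ≥0) + 2}) fun n => by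
    refine ⟨isOpen_lt ((continuous_apply _).comp (_root_.continuous_apply 0)) continuous_const, ?_⟩
    show (n : ℝ≥0) + 1 < n + 2
    gcongr
    exact one_lt_two
  choose a ha using fun n => ((hE n).image fun e => e 0 ((n : ℝ≥0) + 2)).bddAbove
  obtain ⟨h, hh⟩ := exists_apply_nat_gt a
  obtain ⟨n, ⟨e, he, v, hv, hev⟩, -⟩ := Set.mem_iUnion.1 (hcov.ge (Set.mem_univ fun _ => h))
  have h1 : e 0 (v 0 (n + 1)) = h (n + 1) := congrArg (fun f : Fin 1 → HalfLineHomeo => f 0 (n + 1)) hev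
  have h2 : e 0 (v 0 (n + 1)) ≤ a n :=
    ((e 0).strictMono.monotone (le_of_lt hv)).trans (ha n ⟨e, he, rfl⟩)
  exact absurd (h1 ▸ h2) (not_le.2 (hh n))

/-- Rescale the part of the half-line beyond `a`. -/
theorem exists_fix_le_map_eq {a b c : ℝ≥0} (hb : a < b) (hc : a < c) :
    ∃ g : HalfLineHomeo, (∀ t ≤ a, g t = t) ∧ g b = c := by
  set l : ℝ≥0 := (c - a) / (b - a) with hl
  have hl0 : 0 < l := div_pos (tsub_pos_of_lt hc) (tsub_pos_of_lt hb)
  have hm : StrictMono fun t : ℝ≥0 => min t a + (t - a) * l := by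
    intro s t hst
    rcases le_or_gt t a with h | h
    · simp [min_eq_left h, min_eq_left (hst.le.trans h), tsub_eq_zero_of_le h,
        tsub_eq_zero_of_le (hst.le.trans h), hst]
    · refine add_lt_add_of_le_of_lt (min_le_min_right a hst.le) (mul_lt_mul_of_pos_right ?_ hl0)
      rcases le_or_gt s a with h' | h'
      · rw [tsub_eq_zero_of_le h']
        exact tsub_pos_of_lt h
      · exact tsub_lt_tsub_right_of_le h'.le hst
  obtain ⟨g, hg⟩ := exists_eq_of_strictMono (by fun_prop) hm (by simp) fun y =>
    ⟨a + y / l, by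
      rw [add_tsub_cancel_left, div_mul_cancel₀ _ hl0.ne']
      exact le_add_self⟩
  refine ⟨g, fun t ht => ?_, ?_⟩
  · rw [hg, min_eq_left ht, tsub_eq_zero_of_le ht, zero_mul, add_zero]
  · rw [hg, min_eq_right hb.le, hl, mul_div_cancel₀ _ (tsub_pos_of_lt hb).ne',
      add_tsub_cancel_of_le hc.le]

/-- A finite increasing partial map of the open half-line extends to a homeomorphism. -/
theorem exists_extension (s : Finset ℝ≥0) {f : ℝ≥0 → ℝ≥0} (hf : StrictMonoOn f s)
    (hpos : ∀ t ∈ s, 0 < t ∧ 0 < f t) : ∃ h : HalfLineHomeo, ∀ t ∈ s, h t = f t := by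
  induction s using Finset.induction_on_max with
  | empty => exact ⟨1, by simp⟩
  | insert a s hlt ih =>
    have ha : a ∈ insert a s := Finset.mem_insert_self a s
    obtain ⟨h, hh⟩ := ih (hf.mono (Finset.coe_subset.2 (Finset.subset_insert a s)))
      fun t ht => hpos t (Finset.mem_insert_of_mem ht)
    have h1 : s.sup f < h a := by
      refine (Finset.sup_lt_iff ?_).2 fun t ht => ?_
      · exact h.map_zero.symm.trans_lt (h.strictMono (hpos a ha).1)
      · exact hh t ht ▸ h.strictMono (hlt t ht)
    have h2 : s.sup f < f a := (Finset.sup_lt_iff (hpos a ha).2).2 fun t ht =>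
      hf (Finset.mem_insert_of_mem ht) ha (hlt t ht)
    obtain ⟨g, hg1, hg2⟩ := exists_fix_le_map_eq h1 h2
    refine ⟨g * h, fun t ht => ?_⟩
    rw [Homeomorph.mul_apply]
    rcases Finset.mem_insert.1 ht with rfl | ht
    · exact hg2
    · rw [hh t ht, hg1 _ (Finset.le_sup ht)]

/-- The group is Roelcke precompact: a neighbourhood of `1` contains the stabilizer of the points of
a finite set `S`, and the double coset of `h` with respect to this stabilizer is determined by the
order relations between the points `h s` and the points of `S`. -/
theorem exists_finite_mul_mul_eq_univ {U : Set HalfLineHomeo} (hU : U ∈ 𝓝 1) :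
    ∃ E : Set HalfLineHomeo, E.Finite ∧ U * E * U = Set.univ := by
  classical
  obtain ⟨S, hS⟩ : ∃ S : Finset ℝ≥0, ∀ u : HalfLineHomeo, (∀ s ∈ S, u s = s) → u ∈ U := by
    rw [isInducing_coe.nhds_eq_comap, mem_comap] at hU
    obtain ⟨V, hV, hVU⟩ := hU
    rw [nhds_pi, Filter.mem_pi] at hV
    obtain ⟨I, hI, t, ht, hsub⟩ := hV
    refine ⟨hI.toFinset, fun u hu => hVU (hsub fun s hs => ?_)⟩
    show u s ∈ t s
    rw [hu s (hI.mem_toFinset.2 hs)]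
    exact mem_of_mem_nhds (ht s)
  let pat : HalfLineHomeo → S → S → Prop × Prop := fun h s s' => (h s < s', s' < h s)
  refine ⟨Set.range (Function.invFun pat), Set.finite_range _, Set.eq_univ_of_forall fun h => ?_⟩
  set g := Function.invFun pat (pat h) with hg
  have hpat : pat g = pat h := Function.invFun_eq ⟨h, rfl⟩
  have h1 : ∀ s ∈ S, ∀ s' ∈ S, (g s < s' ↔ h s < s') := fun s hs s' hs' =>
    iff_of_eq (congrArg Prod.fst (congrFun (congrFun hpat ⟨s, hs⟩) ⟨s', hs'⟩))
  have h2 : ∀ s ∈ S, ∀ s' ∈ S, (s' < g s ↔ s' < h s) := fun s hs s' hs' =>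
    iff_of_eq (congrArg Prod.snd (congrFun (congrFun hpat ⟨s, hs⟩) ⟨s', hs'⟩))
  let f : ℝ≥0 → ℝ≥0 := fun t => if t ∈ S then t else h (g⁻¹ t)
  have hfS : ∀ s ∈ S, f s = s := fun s hs => if_pos hs
  have hfg : ∀ s ∈ S, f (g s) = h s := fun s hs => by
    by_cases hgs : g s ∈ S
    · rw [hfS _ hgs]
      refine le_antisymm (not_lt.1 fun hlt => ?_) (not_lt.1 fun hlt => ?_)
      · exact lt_irrefl _ ((h1 s hs _ hgs).2 hlt)
      · exact lt_irrefl _ ((h2 s hs _ hgs).2 hlt)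
    · simp only [f, if_neg hgs, inv_apply_apply]
  have hmono : ∀ t ∈ S ∪ S.image g, ∀ t' ∈ S ∪ S.image g, t < t' → f t < f t' := by
    intro t ht t' ht' hlt
    rw [Finset.mem_union, Finset.mem_image] at ht ht'
    rcases ht with ht | ⟨s, hs, rfl⟩ <;> rcases ht' with ht' | ⟨s', hs', rfl⟩
    · rwa [hfS t ht, hfS t' ht']
    · rw [hfS t ht, hfg s' hs']
      exact (h2 s' hs' t ht).1 hlt
    · rw [hfg s hs, hfS t' ht']
      exact (h1 s hs t' ht').1 hlt
    · rw [hfg s hs, hfg s' hs']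
      exact h.strictMono (g.strictMono.lt_iff_lt.1 hlt)
  have hf0 : ∀ t ∈ S ∪ S.image g, 0 < t → 0 < f t := by
    intro t ht h0
    rw [Finset.mem_union, Finset.mem_image] at ht
    rcases ht with ht | ⟨s, hs, rfl⟩
    · rwa [hfS t ht]
    · rw [hfg s hs, ← h.map_zero]
      rw [← g.map_zero] at h0
      exact h.strictMono (g.strictMono.lt_iff_lt.1 h0)
  obtain ⟨β, hβ⟩ := exists_extension ((S ∪ S.image g).filter (0 < ·)) (f := f)
    (fun t ht t' ht' hlt => hmono t (Finset.mem_filter.1 ht).1 t' (Finset.mem_filter.1 ht').1 hlt)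
    fun t ht => ⟨(Finset.mem_filter.1 ht).2,
      hf0 t (Finset.mem_filter.1 ht).1 (Finset.mem_filter.1 ht).2⟩
  have hβS : ∀ s ∈ S, β s = s := fun s hs => by
    rcases (zero_le (a := s)).eq_or_lt with rfl | h0
    · exact β.map_zero
    · rw [hβ s (Finset.mem_filter.2 ⟨Finset.mem_union_left _ hs, h0⟩), hfS s hs]
  have hβg : ∀ s ∈ S, β (g s) = h s := fun s hs => by
    rcases (zero_le (a := s)).eq_or_lt with rfl | h0
    · rw [g.map_zero, h.map_zero, β.map_zero]
    · rw [hβ, hfg s hs]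
      refine Finset.mem_filter.2
        ⟨Finset.mem_union_right _ (Finset.mem_image_of_mem _ hs), ?_⟩
      exact g.map_zero ▸ g.strictMono h0
  refine ⟨β * g, ⟨β, hS β hβS, g, ⟨pat h, rfl⟩, rfl⟩, g⁻¹ * β⁻¹ * h, hS _ fun s hs => ?_, ?_⟩
  · rw [Homeomorph.mul_apply, Homeomorph.mul_apply, ← hβg s hs, inv_apply_apply, inv_apply_apply]
  · simp [mul_assoc]

end HalfLineHomeo

end FMenger

theorem mainTheorem3 (F : Ultrafilter ℕ) (hF : FMenger.IsFree F) :
    -- topological monoids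
    (∀ (X : Type u) [Monoid X] [TopologicalSpace X] [ContinuousMul X]
        [FirstCountableTopology X],
      FMenger.IsTwoSidedOmegaBounded X → FMenger.IsBalanced X →
      (∃ k : ℕ, ¬ FMenger.IsMengerMonoid (Fin k → X)) →
        (FMenger.CfMonoidExists X F →
          FMenger.cfMonoid X F = (Cardinal.lift.{u} (FMenger.b F)).ord ∧
          FMenger.b F = FMenger.q F) ∧
        ((∀ L : Ultrafilter ℕ, FMenger.IsQPoint L → ¬ FMenger.Coherent F L) →
          FMenger.CfMonoidExists X F ∧
          FMenger.cfMonoid X F = (Cardinal.lift.{u} (FMenger.b F)).ord ∧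
          FMenger.b F = FMenger.q F)) ∧
    -- topological groups
    (∀ (X : Type u) [Group X] [TopologicalSpace X] [IsTopologicalGroup X]
        [FirstCountableTopology X],
      FMenger.IsOmegaBounded X →
      (∃ k : ℕ, ¬ FMenger.IsMengerMonoid (Fin k → X)) →
        (FMenger.CfGroupExists X F →
          FMenger.cfGroup X F = (Cardinal.lift.{u} (FMenger.b F)).ord ∧
          FMenger.b F = FMenger.q F) ∧
        ((∀ L : Ultrafilter ℕ, FMenger.IsQPoint L → ¬ FMenger.Coherent F L) →
          FMenger.CfGroupExists X F ∧
          FMenger.cfGroup X F = (Cardinal.lift.{u} (FMenger.b F)).ord ∧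
          FMenger.b F = FMenger.q F)) ∧
    -- the homeomorphism group of the half-line
    ((FMenger.CfMonoidExists FMenger.HalfLineHomeo F ↔
        FMenger.CfGroupExists FMenger.HalfLineHomeo F) ∧
      (FMenger.CfGroupExists FMenger.HalfLineHomeo F ↔
        ∀ L : Ultrafilter ℕ, FMenger.IsQPoint L → ¬ FMenger.Coherent F L)) := by
  refine ⟨fun X _ _ _ _ hb hbal hX => ?_, fun X _ _ _ _ hb hX => ?_, ?_⟩
  · obtain ⟨s⟩ := FMenger.nonempty_scaledNets hb hbal
    refine ⟨FMenger.cfMonoid_of_exists s hF, fun hQ => ?_⟩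
    have hex := FMenger.cfMonoidExists_of_not_coherent s hF hQ hX
    exact ⟨hex, FMenger.cfMonoid_of_exists s hF hex⟩
  · obtain ⟨s⟩ := FMenger.nonempty_scaledNets_of_group hb
    refine ⟨FMenger.cfGroup_of_exists s hF, fun hQ => ?_⟩
    have hex := FMenger.cfGroupExists_of_not_coherent s hF hQ hX
    exact ⟨hex, FMenger.cfGroup_of_exists s hF hex⟩
  · have h1 : FMenger.CfMonoidExists FMenger.HalfLineHomeo F →
        ∀ L : Ultrafilter ℕ, FMenger.IsQPoint L → ¬ FMenger.Coherent F L := fun h L hL hFL =>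
      FMenger.not_cfMonoidExists_of_coherent
        (fun U hU => FMenger.HalfLineHomeo.exists_finite_mul_mul_eq_univ hU) hF hL hFL h
    have h2 : (∀ L : Ultrafilter ℕ, FMenger.IsQPoint L → ¬ FMenger.Coherent F L) →
        FMenger.CfGroupExists FMenger.HalfLineHomeo F := fun hQ => by
      obtain ⟨s⟩ := FMenger.nonempty_scaledNets_of_group (X := FMenger.HalfLineHomeo)
        FMenger.isOmegaBounded_of_separable
      exact FMenger.cfGroupExists_of_not_coherent s hF hQ ⟨1, FMenger.HalfLineHomeo.not_isMengerMonoid⟩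
    exact ⟨⟨fun h => h2 (h1 h), fun h => h.cfMonoidExists⟩, fun h => h1 h.cfMonoidExists, h2⟩
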